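/- **Notation.** Let $\tau, z, v, z_1, z_2, t\in\mathbb C$ with $\operatorname{Im}\tau>0$, and $q^r=e^{2\pi i r\tau}$. For integers $k\ge 1$ and $j$ put $$\Theta_{j,k}(\tau,z)=\sum_{n\in\mathbb Z+\frac{j}{2k}} q^{kn^2}e^{2\pi i k n z},$$ $$R_{k;j}(\tau,v)=\sum_{\substack{n\in\mathbb Z\\ n\equiv j \bmod 2k}}\Big(\operatorname{sign}(n+\tfrac12)-E\Big(\big(n+2k\tfrac{\operatorname{Im} v}{\operatorname{Im}\tau}\big)\big(\tfrac{\operatorname{Im}\tau}{k}\big)^{1/2}\Big)\Big)e^{-\frac{\pi i n^2}{2k}\tau-2\pi i n v},\qquad E(x)=2\int_0^x e^{-\pi u^2}\,du .$$ For an integer $m\ge 0$ let $$\Phi^{[m]}(\tau,z_1,z_2,t)=e^{2\pi i(m+1)t}\sum_{j\in\mathbb Z}\Big(\frac{e^{2\pi i j(m+1)(z_1+z_2)}q^{j^2(m+1)}}{1-e^{2\pi i z_1}q^j}-\frac{e^{-2\pi i j(m+1)(z_1+z_2)}q^{j^2(m+1)}}{1-e^{-2\pi i z_2}q^j}\Big),$$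 $$\tilde\Phi^{[m]}(\tau,z_1,z_2,t)=\Phi^{[m]}(\tau,z_1,z_2,t)-\tfrac12 e^{2\pi i(m+1)t}\sum_{j\in\mathbb Z/(2m+2)\mathbb Z}R_{m+1;j}\big(\tau,\tfrac{z_1-z_2}{2}\big)\,(\Theta_{j,m+1}-\Theta_{-j,m+1})(\tau,z_1+z_2).$$ For an integer $M\ge 1$, $\epsilon,\epsilon'\in\{0,\tfrac12\}$ and $j,k\in\epsilon'+\mathbb Z$ let $$\tilde\Psi^{[M,m;\epsilon]}_{j,k;\epsilon'}(\tau,z_1,z_2,t)=q^{\frac{(m+1)jk}{M}}e^{\frac{2\pi i(m+1)}{M}(kz_1+jz_2)}\,\tilde\Phi^{[m]}\big(M\tau,\,z_1+j\tau+\epsilon,\,z_2+k\tau+\epsilon,\,\tfrac tM\big).$$ Let $$D_1=\frac1{2\pi i}\Big(\frac{\partial}{\partial z_1}-\frac{\partial}{\partial z_2}-\frac{z_1-z_2}{2\tau}\frac{\partial}{\partial t}\Big),$$ where $\partial/\partial z=\frac12(\partial/\partial x-i\,\partial/\partial y)$ for $z=x+iy$, and for $m\ge1$ put $$\tilde\Phi^{A_{1|1}[m]}=D_1\tilde\Phi^{[m-1]},\qquad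 \tilde\Psi^{A_{1|1}[M,m;\epsilon]}_{j,k;\epsilon'}=D_1\tilde\Psi^{[M,m-1;\epsilon]}_{j,k;\epsilon'}.$$ **Theorem 8.2.** (a) Let $m$ be a positive integer, $\operatorname{Im}\tau>0$, $t\in\mathbb C$ and $z_1,z_2\notin\mathbb Z+\mathbb Z\tau$. Then $\tilde\Phi^{[m-1]}(\tau,\cdot,\cdot,\cdot)$ is differentiable in the real sense at $(z_1,z_2,t)$, and $$\tilde\Phi^{A_{1|1}[m]}\Big(-\frac1\tau,\frac{z_1}\tau,\frac{z_2}\tau,t-\frac{z_1z_2}\tau\Big)=\tau^2\,\tilde\Phi^{A_{1|1}[m]}(\tau,z_1,z_2,t).$$ (b) Let $M$ and $m$ be positive integers such that $\gcd(M,2m)=1$ if $m>1$. Let $\epsilon,\epsilon'\in\{0,\frac12\}$, $j,k\in\epsilon'+\mathbb Z$, $\operatorname{Im}\tau>0$, $t\in\mathbb C$, and $z_1,z_2\notin(\epsilon'+\mathbb Z)+(\epsilon+\mathbb Z)\tau$. Then $$\tilde\Psi^{A_{1|1}[M,m;\epsilon]}_{j,k;\epsilon'}\Big(-\frac1\tau,\frac{z_1}\tau,\frac{z_2}\tau,t-\frac{z_1z_2}\tau\Big)=\frac{\tau^2}{M}\sum_{a,b\in\epsilon+\mathbb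 Z/M\mathbb Z}e^{-\frac{2\pi i m}{M}(ak+bj)}\,\tilde\Psi^{A_{1|1}[M,m;\epsilon']}_{a,b;\epsilon}(\tau,z_1,z_2,t),$$ where $a$ and $b$ each run over an arbitrary set of representatives of the classes of $\epsilon+\mathbb Z$ modulo $M\mathbb Z$. -/

import Mathlib

noncomputable section

namespace MockTheta

open Complex

/-- The function `E(x) = 2 ∫₀ˣ e^{-π u²} du` (only real arguments are needed). -/
def E (x : ℝ) : ℝ := 2 * ∫ u in (0 : ℝ)..x, Real.exp (-Real.pi * u ^ 2)

/-- The complex power `q^r = e^{2π i r τ}`. -/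
def qpow (τ r : ℂ) : ℂ := cexp (2 * Real.pi * I * r * τ)

/-- The theta function of degree `k` (at `t = 0`), the sum of `q^{k n²} e^{2π i k n z}`
over `n ∈ ℤ + j / (2k)`.  It depends only on `j` modulo `2k`. -/
def Theta (j : ℤ) (k : ℕ) (τ z : ℂ) : ℂ :=
  ∑' l : ℤ, qpow τ (k * ((l : ℂ) + j / (2 * k)) ^ 2) *
    cexp (2 * Real.pi * I * k * ((l : ℂ) + j / (2 * k)) * z)

/-- The summand of Zwegers' function `R_{m;j}` attached to the integer `n`. -/
def RTerm (m : ℕ) (n : ℤ) (τ v : ℂ) : ℂ :=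
  ((Real.sign ((n : ℝ) + 1 / 2) -
      E (((n : ℝ) + 2 * m * (v.im / τ.im)) * Real.sqrt (τ.im / m)) : ℝ) : ℂ) *
    cexp (-(Real.pi * I * (n : ℂ) ^ 2 / (2 * m) * τ) - 2 * Real.pi * I * n * v)

/-- Zwegers' real analytic function `R_{m;j}`: the sum over all integers `n ≡ j mod 2m`,
written as `n = j + 2 m l` with `l ∈ ℤ`. -/
def R (m : ℕ) (j : ℤ) (τ v : ℂ) : ℂ :=
  ∑' l : ℤ, RTerm m (j + 2 * m * l) τ v

/-- The mock theta function `Φ^{[m]}`. -/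
def Phi (m : ℕ) (τ z₁ z₂ t : ℂ) : ℂ :=
  cexp (2 * Real.pi * I * (m + 1) * t) *
    ∑' j : ℤ,
      (cexp (2 * Real.pi * I * j * (m + 1) * (z₁ + z₂)) * qpow τ ((j : ℂ) ^ 2 * (m + 1)) /
          (1 - cexp (2 * Real.pi * I * z₁) * qpow τ j) -
        cexp (-(2 * Real.pi * I * j * (m + 1) * (z₁ + z₂))) * qpow τ ((j : ℂ) ^ 2 * (m + 1)) /
          (1 - cexp (-(2 * Real.pi * I * z₂)) * qpow τ j))

/-- The correction term `Φ^{[m]}_add`; the sum is over `j ∈ ℤ / (2m+2)ℤ`, every summand being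
independent of the representative. -/
def PhiAdd (m : ℕ) (τ z₁ z₂ t : ℂ) : ℂ :=
  -(1 / 2) * cexp (2 * Real.pi * I * (m + 1) * t) *
    ∑ j ∈ Finset.range (2 * m + 2),
      R (m + 1) j τ ((z₁ - z₂) / 2) *
        (Theta j (m + 1) τ (z₁ + z₂) - Theta (-(j : ℤ)) (m + 1) τ (z₁ + z₂))

/-- The modified function `Φ̃^{[m]} = Φ^{[m]} + Φ^{[m]}_add`. -/
def PhiTilde (m : ℕ) (τ z₁ z₂ t : ℂ) : ℂ :=
  Phi m τ z₁ z₂ t + PhiAdd m τ z₁ z₂ t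

/-- The function `Ψ̃^{[M,m;ε]}_{j,k;ε'}`.  The index `ε'` only records the coset `ε' + ℤ`
that contains `j` and `k`; it does not occur in the formula. -/
def PsiTilde (M m : ℕ) (ε j k : ℂ) (τ z₁ z₂ t : ℂ) : ℂ :=
  qpow τ ((m + 1) * j * k / M) *
    cexp (2 * Real.pi * I * (m + 1) / M * (k * z₁ + j * z₂)) *
      PhiTilde m (M * τ) (z₁ + j * τ + ε) (z₂ + k * τ + ε) (t / M)

/-- The Wirtinger derivative `∂f/∂z = (∂f/∂x - i ∂f/∂y) / 2` at `z = x + i y` of a function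
`f : ℂ → ℂ` that need not be holomorphic. -/
def wirtinger (f : ℂ → ℂ) (z : ℂ) : ℂ :=
  (fderiv ℝ f z 1 - I * fderiv ℝ f z I) / 2

/-- The differential operator
`D₁ = (1 / 2πi) (∂/∂z₁ - ∂/∂z₂ - ((z₁ - z₂) / 2τ) ∂/∂t)`. -/
def D₁ (F : ℂ → ℂ → ℂ → ℂ → ℂ) (τ z₁ z₂ t : ℂ) : ℂ :=
  1 / (2 * Real.pi * I) *
    (wirtinger (fun w => F τ w z₂ t) z₁ - wirtinger (fun w => F τ z₁ w t) z₂ -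
      (z₁ - z₂) / (2 * τ) * wirtinger (fun s => F τ z₁ z₂ s) t)

/-- The modified numerator `Φ̃^{A_{1|1}[m]} = D₁ Φ̃^{[m-1]}`, for `m ≥ 1`. -/
def PhiTildeA (m : ℕ) : ℂ → ℂ → ℂ → ℂ → ℂ := D₁ (PhiTilde (m - 1))

/-- The function `Ψ̃^{A_{1|1}[M,m;ε]}_{j,k;ε'} = D₁ Ψ̃^{[M,m-1;ε]}_{j,k;ε'}`, for `m ≥ 1`. -/
def PsiTildeA (M m : ℕ) (ε j k : ℂ) : ℂ → ℂ → ℂ → ℂ → ℂ := D₁ (PsiTilde M (m - 1) ε j k)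

end MockTheta

end

noncomputable section

namespace MockTheta

/-! ### The error function and a completed partial fraction expansion -/

section

open Complex MeasureTheory Set

/-! The completed function is an absolutely convergent sum over the lattice `ℤτ + ℤ` of terms
(exponential with Gaussian decay) / `(z₁ + lτ + n)`, and `τ ↦ -1/τ` essentially permutes the terms
of such a sum.

The lattice form comes from `appell_kernel_eq`: `1 / (1 - e^{2πia})`, corrected by a series of error
functions, equals a Gaussian-damped sum over its poles `a = -n`. As functions of the auxiliary real
parameter `c`, both sides have the same derivative by Poisson summation, and their difference is
multiplied by `e^{-2πia} ≠ 1` under `c ↦ c + 1`; a constant with that property is zero. Applied with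
`a = z₁ + lτ` for each `l`, the pole sums fill the lattice and the error terms regroup into products
of `R` and `Theta` (`hasSum_appellTerm`). Hence `PhiTilde` is an exponential times the
antisymmetrization of `appellSum` under `(z₁, z₂) ↦ (-z₂, -z₁)` (`PhiTilde_eq_appellSum`), which
also gives real differentiability.

For the twisted functions, inversion exchanges the two lattice directions
(`latticeTerm_inv_eq_pairedTerm`). The sum over `b` on the right is a character sum that selects the
sublattice occurring on the left (`sum_zmod_exp`, `appellPsi_modular`); this yields weight one.
Finally `D₁` differentiates along a direction which the substitution `(z₁, z₂, t) ↦ (z₁/τ, z₂/τ, t -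
z₁z₂/τ)` carries to `τ⁻¹` times the corresponding direction, and the substitution is holomorphic, so
`D₁` adds one more factor `τ` (`D₁_modular`). The untwisted law is the case `M = 1`. -/

lemma E_neg (x : ℝ) : E (-x) = -E x := by
  unfold E
  have h := intervalIntegral.integral_comp_neg (a := 0) (b := x)
    (fun u : ℝ => Real.exp (-Real.pi * u ^ 2))
  simp only [neg_sq, neg_zero] at h
  rw [h, intervalIntegral.integral_symm]
  ring

lemma hasDerivAt_E (x : ℝ) : HasDerivAt E (2 * Real.exp (-Real.pi * x ^ 2)) x := by
  have hc : Continuous fun u : ℝ => Real.exp (-Real.pi * u ^ 2) := by fun_prop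
  exact (intervalIntegral.integral_hasDerivAt_right (hc.intervalIntegrable _ _)
    (hc.stronglyMeasurableAtFilter _ _) hc.continuousAt).const_mul 2

lemma integral_Ioi_gaussian_pi : ∫ u in Ioi (0 : ℝ), Real.exp (-Real.pi * u ^ 2) = 1 / 2 := by
  rw [integral_gaussian_Ioi, div_self Real.pi_ne_zero, Real.sqrt_one]

/-- The tail integral from `x`, shifted to start at `0`, is bounded through `(u + x)² ≥ u² + x²` for
`u, x ≥ 0`. -/
lemma abs_one_sub_E_le {x : ℝ} (hx : 0 ≤ x) : |1 - E x| ≤ Real.exp (-Real.pi * x ^ 2) := by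
  have hint : Integrable fun u : ℝ => Real.exp (-Real.pi * u ^ 2) :=
    integrable_exp_neg_mul_sq Real.pi_pos
  have hsplit := intervalIntegral.integral_interval_add_Ioi (a := (0 : ℝ)) (b := x)
    (f := fun u : ℝ => Real.exp (-Real.pi * u ^ 2)) hint.integrableOn hint.integrableOn
  rw [integral_Ioi_gaussian_pi] at hsplit
  have hshift : ∫ u in Ioi x, Real.exp (-Real.pi * u ^ 2) =
      ∫ u in Ioi (0 : ℝ), Real.exp (-Real.pi * (u + x) ^ 2) := by
    have h := (measurePreserving_add_right volume x).setIntegral_preimage_emb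
      (measurableEmbedding_addRight x) (fun u : ℝ => Real.exp (-Real.pi * u ^ 2)) (Ioi x)
    rw [← h]
    simp
  have hle : ∫ u in Ioi (0 : ℝ), Real.exp (-Real.pi * (u + x) ^ 2) ≤
      ∫ u in Ioi (0 : ℝ), Real.exp (-Real.pi * x ^ 2) * Real.exp (-Real.pi * u ^ 2) := by
    refine setIntegral_mono_on (hint.comp_add_right x).integrableOn
      (hint.const_mul _).integrableOn measurableSet_Ioi fun u hu => ?_
    rw [← Real.exp_add]
    refine Real.exp_le_exp.2 ?_
    have : 0 ≤ Real.pi * (u * x) := mul_nonneg Real.pi_pos.le (mul_nonneg (le_of_lt hu) hx)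
    nlinarith
  rw [integral_const_mul, integral_Ioi_gaussian_pi] at hle
  have hnn : 0 ≤ ∫ u in Ioi x, Real.exp (-Real.pi * u ^ 2) :=
    integral_nonneg fun u => (Real.exp_pos _).le
  have hE : 1 - E x = 2 * ∫ u in Ioi x, Real.exp (-Real.pi * u ^ 2) := by
    unfold E
    linarith
  rw [hE, abs_of_nonneg (by positivity), hshift]
  linarith

lemma abs_sign_sub_E_le (x : ℝ) : |Real.sign x - E x| ≤ Real.exp (-Real.pi * x ^ 2) := by
  rcases lt_trichotomy x 0 with h | h | h
  · rw [Real.sign_of_neg h]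
    have := abs_one_sub_E_le (x := -x) (by linarith)
    rw [E_neg, neg_sq] at this
    rwa [← abs_neg, show -(-1 - E x) = 1 - -E x by ring]
  · subst h
    simp [E]
  · rw [Real.sign_of_pos h]
    exact abs_one_sub_E_le h.le

lemma abs_sign_le_one (x : ℝ) : |Real.sign x| ≤ 1 := by
  rcases Real.sign_apply_eq x with h | h | h <;> simp [h]

lemma abs_E_le_two (x : ℝ) : |E x| ≤ 2 := by
  have h1 := abs_sign_sub_E_le x
  have h2 : Real.exp (-Real.pi * x ^ 2) ≤ 1 := by
    rw [Real.exp_le_one_iff]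
    have := Real.pi_pos
    have := sq_nonneg x
    nlinarith
  have h3 := abs_sign_le_one x
  rw [abs_le] at *
  constructor <;> linarith

/-- The difference `sign (r + 1/2) - E ((r + c) / √A)` has Gaussian decay in `r`. -/
lemma abs_sign_half_sub_E_le {A : ℝ} (hA : 0 < A) (c : ℝ) :
    ∃ K : ℝ, ∀ r : ℤ, |Real.sign ((r : ℝ) + 1 / 2) - E (((r : ℝ) + c) / √A)| ≤
      K * Real.exp (-Real.pi * ((r : ℝ) + c) ^ 2 / A) := by
  have hs : 0 < √A := Real.sqrt_pos.2 hA
  have hsq : ∀ x : ℝ, -Real.pi * (x / √A) ^ 2 = -Real.pi * x ^ 2 / A := fun x => by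
    rw [div_pow, Real.sq_sqrt hA.le, mul_div_assoc]
  -- If `r + 1/2` and `r + c` have the same sign, the tail bound for `E` suffices. Otherwise `|r +
  -- c| ≤ |c - 1/2|`, so the exponential in the constant offsets the Gaussian, and `3 = 1 + 2`
  -- bounds sign and `E` trivially.
  refine ⟨3 * Real.exp (Real.pi * (c - 1 / 2) ^ 2 / A), fun r => ?_⟩
  have hK : 1 ≤ Real.exp (Real.pi * (c - 1 / 2) ^ 2 / A) :=
    Real.one_le_exp (by positivity)
  have hpos := Real.exp_pos (-Real.pi * ((r : ℝ) + c) ^ 2 / A)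
  by_cases h : Real.sign ((r : ℝ) + 1 / 2) = Real.sign (((r : ℝ) + c) / √A)
  · rw [h]
    have := abs_sign_sub_E_le (((r : ℝ) + c) / √A)
    rw [hsq] at this
    nlinarith
  · have hle : ((r : ℝ) + c) ^ 2 ≤ (c - 1 / 2) ^ 2 := by
      rw [sq_le_sq]
      by_contra! hlt
      apply h
      rcases le_or_gt 0 ((r : ℝ) + c) with h0 | h0
      · rw [abs_of_nonneg h0] at hlt
        have h1 : 0 < (r : ℝ) + 1 / 2 := by linarith [le_abs_self (c - 1 / 2)]
        have h2 : 0 < ((r : ℝ) + c) / √A :=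
          div_pos (by linarith [abs_nonneg (c - 1 / 2)]) hs
        rw [Real.sign_of_pos h1, Real.sign_of_pos h2]
      · rw [abs_of_neg h0] at hlt
        have h1 : (r : ℝ) + 1 / 2 < 0 := by linarith [neg_abs_le (c - 1 / 2)]
        rw [Real.sign_of_neg h1, Real.sign_of_neg (div_neg_of_neg_of_pos h0 hs)]
    have h1 : |Real.sign ((r : ℝ) + 1 / 2) - E (((r : ℝ) + c) / √A)| ≤ 3 := by
      have h1 := abs_sign_le_one ((r : ℝ) + 1 / 2)
      have h2 := abs_E_le_two (((r : ℝ) + c) / √A)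
      rw [abs_le] at *
      constructor <;> linarith
    refine h1.trans ?_
    rw [mul_assoc, ← Real.exp_add]
    have : 1 ≤ Real.exp (Real.pi * (c - 1 / 2) ^ 2 / A + -Real.pi * ((r : ℝ) + c) ^ 2 / A) := by
      apply Real.one_le_exp
      rw [← add_div]
      apply div_nonneg _ hA.le
      nlinarith [Real.pi_pos]
    linarith

lemma summable_exp_quadratic {α : ℝ} (hα : 0 < α) (β γ : ℝ) :
    Summable fun n : ℤ => Real.exp (-α * (n : ℝ) ^ 2 + β * |(n : ℝ)| + γ) := by
  have h := (summable_pow_mul_jacobiTheta₂_term_bound (β / (2 * Real.pi))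
    (T := α / Real.pi) (div_pos hα Real.pi_pos) 0).mul_right (Real.exp γ)
  refine h.congr fun n => ?_
  rw [pow_zero, one_mul, ← Real.exp_add]
  congr 1
  have := Real.pi_ne_zero
  push_cast
  field_simp
  ring

lemma summable_of_norm_le_exp_quadratic {f : ℤ → ℂ} {α β γ K : ℝ} (hα : 0 < α)
    (h : ∀ n, ‖f n‖ ≤ K * Real.exp (-α * (n : ℝ) ^ 2 + β * |(n : ℝ)| + γ)) : Summable f :=
  ((summable_exp_quadratic hα β γ).mul_left K).of_norm_bounded h

/-- Poisson summation for a Gaussian, the common derivative of both sides of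
`appell_kernel_eq`. -/
lemma tsum_gaussian_poisson {A : ℝ} (hA : 0 < A) (c : ℝ) (a : ℂ) :
    ∑' n : ℤ, cexp (-Real.pi * A * (a + n) ^ 2 - 2 * Real.pi * I * c * (a + n)) =
      ((√A)⁻¹ : ℝ) * ∑' r : ℤ, ((Real.exp (-Real.pi * ((r : ℝ) + c) ^ 2 / A) : ℝ) : ℂ) *
        cexp (2 * Real.pi * I * r * a) := by
  have hA' : (A : ℂ) ≠ 0 := ofReal_ne_zero.2 hA.ne'
  have hs : ((√A : ℝ) : ℂ) ≠ 0 := ofReal_ne_zero.2 (Real.sqrt_pos.2 hA).ne'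
  have hP := Complex.tsum_exp_neg_quadratic (a := ((A⁻¹ : ℝ) : ℂ))
    (by rw [ofReal_re]; exact inv_pos.2 hA) (-c / A + I * a)
  have hroot : 1 / (((A⁻¹ : ℝ) : ℂ)) ^ (1 / 2 : ℂ) = ((√A : ℝ) : ℂ) := by
    have h2 : (1 / 2 : ℂ) = ((1 / 2 : ℝ) : ℂ) := by push_cast; rfl
    rw [h2, ← ofReal_cpow (inv_pos.2 hA).le, ← Real.sqrt_eq_rpow, Real.sqrt_inv]
    push_cast
    rw [one_div, inv_inv]
  rw [hroot] at hP
  have hL : ∑' r : ℤ, ((Real.exp (-Real.pi * ((r : ℝ) + c) ^ 2 / A) : ℝ) : ℂ) *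
        cexp (2 * Real.pi * I * r * a) = cexp (-Real.pi * c ^ 2 / A) *
      ∑' n : ℤ, cexp (-Real.pi * ((A⁻¹ : ℝ) : ℂ) * n ^ 2 +
        2 * Real.pi * (-c / A + I * a) * n) := by
    rw [← tsum_mul_left]
    refine tsum_congr fun n => ?_
    push_cast
    rw [← Complex.exp_add, ← Complex.exp_add]
    congr 1
    field_simp
    ring
  -- The dual sum has `n - a` where `a + n` is wanted, hence the reindexing `n ↦ -n`.
  rw [hL, hP, ← (Equiv.neg ℤ).tsum_eq fun n : ℤ => cexp (-Real.pi / ((A⁻¹ : ℝ) : ℂ) * _ ^ 2)]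
  rw [ofReal_inv, mul_left_comm, inv_mul_cancel_left₀ hs, ← tsum_mul_left]
  refine tsum_congr fun n => ?_
  rw [← Complex.exp_add]
  congr 1
  rw [Equiv.neg_apply]
  push_cast
  field_simp
  linear_combination (-(A : ℂ) ^ 2 * a ^ 2 * (1 - I ^ 2) - 2 * A * a * I * c +
    c ^ 2 - 2 * A ^ 2 * a * n) * I_sq

/-- The theta-like sum in the kernel identity. -/
def kernelSum (A c : ℝ) (a : ℂ) : ℂ :=
  ∑' n : ℤ, cexp (-Real.pi * A * (a + n) ^ 2 - 2 * Real.pi * I * c * (a + n)) / (a + n)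

/-- The series of error functions in the kernel identity. -/
def errorSum (A c : ℝ) (a : ℂ) : ℂ :=
  ∑' r : ℤ, ((Real.sign ((r : ℝ) + 1 / 2) - E (((r : ℝ) + c) / √A) : ℝ) : ℂ) *
    cexp (2 * Real.pi * I * r * a)

lemma norm_gaussian_shift (A c : ℝ) (a : ℂ) (n : ℤ) :
    ‖cexp (-Real.pi * A * (a + n) ^ 2 - 2 * Real.pi * I * c * (a + n))‖ =
      Real.exp (-Real.pi * A * ((a.re + n) ^ 2 - a.im ^ 2) + 2 * Real.pi * c * a.im) := by
  rw [Complex.norm_exp]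
  congr 1
  simp [pow_two]

lemma one_le_norm_of_int {a : ℂ} (ha : ∀ n : ℤ, a ≠ n) :
    ∃ δ > 0, ∀ n : ℤ, δ ≤ ‖a + n‖ := by
  by_cases him : a.im = 0
  · refine ⟨min (Int.fract a.re) (1 - Int.fract a.re), ?_, fun n => ?_⟩
    · refine lt_min (lt_of_le_of_ne (Int.fract_nonneg _) fun h => ?_)
        (by linarith [Int.fract_lt_one a.re])
      apply ha ⌊a.re⌋
      apply Complex.ext
      · rw [Int.fract] at h
        rw [intCast_re]
        linarith
      · rw [intCast_im, him]
    · have h1 : |a.re + n| ≤ ‖a + n‖ := by simpa using Complex.abs_re_le_norm (a + n)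
      refine le_trans ?_ h1
      have hf := Int.self_sub_floor a.re
      rcases le_or_gt 0 (⌊a.re⌋ + n) with h | h
      · refine (min_le_left _ _).trans (le_trans ?_ (le_abs_self _))
        have : (0 : ℝ) ≤ ⌊a.re⌋ + n := by exact_mod_cast h
        linarith
      · refine (min_le_right _ _).trans (le_trans ?_ (neg_le_abs _))
        have : ((⌊a.re⌋ + n : ℤ) : ℝ) ≤ -1 := by exact_mod_cast (by omega)
        push_cast at this
        linarith
  · refine ⟨|a.im|, abs_pos.2 him, fun n => ?_⟩
    simpa using Complex.abs_im_le_norm (a + n)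

lemma exp_shift_le {A : ℝ} (hA : 0 < A) (x B : ℝ) (n : ℤ) :
    Real.exp (-Real.pi * A * ((x + n) ^ 2 - B)) ≤
      1 * Real.exp (-(Real.pi * A) * (n : ℝ) ^ 2 + (2 * Real.pi * A * |x|) * |(n : ℝ)| +
        Real.pi * A * B) := by
  rw [one_mul]
  refine Real.exp_le_exp.2 ?_
  have h1 : -(x * n) ≤ |x| * |(n : ℝ)| := by rw [← abs_mul]; exact neg_le_abs _
  have h2 : 0 < Real.pi * A := mul_pos Real.pi_pos hA
  nlinarith [mul_le_mul_of_nonneg_left h1 h2.le, mul_nonneg h2.le (sq_nonneg x)]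

lemma summable_kernelSum {A : ℝ} (hA : 0 < A) (c : ℝ) {a : ℂ} (ha : ∀ n : ℤ, a ≠ n) :
    Summable fun n : ℤ =>
      cexp (-Real.pi * A * (a + n) ^ 2 - 2 * Real.pi * I * c * (a + n)) / (a + n) := by
  obtain ⟨δ, hδ, hle⟩ := one_le_norm_of_int ha
  refine summable_of_norm_le_exp_quadratic (α := Real.pi * A) (β := 2 * Real.pi * A * |a.re|)
    (γ := Real.pi * A * a.im ^ 2) (K := Real.exp (2 * Real.pi * c * a.im) / δ)
    (mul_pos Real.pi_pos hA) fun n => ?_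
  rw [norm_div, norm_gaussian_shift, Real.exp_add, div_mul_eq_mul_div,
    mul_comm (Real.exp _) (Real.exp (2 * _ * _ * _))]
  have h := exp_shift_le hA a.re (a.im ^ 2) n
  rw [one_mul] at h
  exact div_le_div₀ (by positivity) (mul_le_mul_of_nonneg_left h (Real.exp_pos _).le) hδ (hle n)

lemma hasDerivAt_tsum_of_unit_ball {g g' : ℤ → ℝ → ℂ} {u : ℤ → ℝ} (hu : Summable u) (c : ℝ)
    (hg : ∀ n x, |x - c| < 1 → HasDerivAt (g n) (g' n x) x)
    (hg' : ∀ n x, |x - c| < 1 → ‖g' n x‖ ≤ u n) (h0 : Summable fun n => g n c) :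
    HasDerivAt (fun x => ∑' n, g n x) (∑' n, g' n c) c :=
  hasDerivAt_tsum_of_isPreconnected hu Metric.isOpen_ball (convex_ball c 1).isPreconnected
    (fun n x hx => hg n x (by simpa [Real.dist_eq] using hx))
    (fun n x hx => hg' n x (by simpa [Real.dist_eq] using hx))
    (Metric.mem_ball_self one_pos) h0 (Metric.mem_ball_self one_pos)

/-- Differentiating in `c` brings down `a + n`, which cancels the denominator and leaves a pure
Gaussian sum, ready for Poisson summation. -/
lemma hasDerivAt_kernelSum {A : ℝ} (hA : 0 < A) (c : ℝ) {a : ℂ} (ha : ∀ n : ℤ, a ≠ n) :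
    HasDerivAt (fun c => kernelSum A c a)
      (-2 * Real.pi * I *
        ∑' n : ℤ, cexp (-Real.pi * A * (a + n) ^ 2 - 2 * Real.pi * I * c * (a + n))) c := by
  obtain ⟨δ, hδ, hle⟩ := one_le_norm_of_int ha
  rw [← tsum_mul_left]
  unfold kernelSum
  have hb := ((summable_exp_quadratic (mul_pos Real.pi_pos hA) (2 * Real.pi * A * |a.re|)
    (Real.pi * A * a.im ^ 2)).mul_left (1 : ℝ)).mul_left
      (2 * Real.pi * Real.exp (2 * Real.pi * (|c| + 1) * |a.im|))
  refine hasDerivAt_tsum_of_unit_ball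
    (g := fun (n : ℤ) (x : ℝ) =>
      cexp (-Real.pi * A * (a + n) ^ 2 - 2 * Real.pi * I * x * (a + n)) / (a + n))
    (g' := fun (n : ℤ) (x : ℝ) => -2 * Real.pi * I *
      cexp (-Real.pi * A * (a + n) ^ 2 - 2 * Real.pi * I * x * (a + n)))
    hb c (fun n x _ => ?_) (fun n x hx => ?_) (summable_kernelSum hA c ha)
  · have hn : a + n ≠ 0 := norm_pos_iff.1 (hδ.trans_le (hle n))
    have h1 : HasDerivAt (fun x : ℝ => (x : ℂ)) 1 x := Complex.ofRealCLM.hasDerivAt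
    have h2 := ((((h1.const_mul (2 * Real.pi * I)).mul_const (a + n)).const_sub
      (-Real.pi * A * (a + n) ^ 2)).cexp).div_const (a + n)
    convert! h2 using 1
    field_simp
  · have hx' : |x| ≤ |c| + 1 := by linarith [abs_sub_abs_le_abs_sub x c]
    rw [norm_mul, norm_gaussian_shift, Real.exp_add]
    have h := exp_shift_le hA a.re (a.im ^ 2) n
    have h4 : ‖-2 * (Real.pi : ℂ) * I‖ = 2 * Real.pi := by
      simp [abs_of_pos Real.pi_pos]
    have h5 : Real.exp (2 * Real.pi * x * a.im) ≤
        Real.exp (2 * Real.pi * (|c| + 1) * |a.im|) := by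
      refine Real.exp_le_exp.2 ?_
      have : x * a.im ≤ (|c| + 1) * |a.im| := by
        refine (le_abs_self _).trans ?_
        rw [abs_mul]
        gcongr
      nlinarith [Real.pi_pos]
    rw [h4, mul_comm (Real.exp _) (Real.exp (2 * Real.pi * x * a.im)), ← mul_assoc]
    gcongr

lemma norm_exp_two_pi (r : ℤ) (a : ℂ) :
    ‖cexp (2 * Real.pi * I * r * a)‖ = Real.exp (-(2 * Real.pi * r * a.im)) := by
  rw [Complex.norm_exp]
  congr 1
  simp

lemma exp_shift_mul_le {A : ℝ} (hA : 0 < A) {c C : ℝ} (hc : |c| ≤ C) (a : ℂ) (r : ℤ) :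
    Real.exp (-Real.pi * ((r : ℝ) + c) ^ 2 / A) * ‖cexp (2 * Real.pi * I * r * a)‖ ≤
      Real.exp (-(Real.pi / A) * (r : ℝ) ^ 2 +
        (2 * Real.pi / A * C + 2 * Real.pi * |a.im|) * |(r : ℝ)| + 0) := by
  rw [norm_exp_two_pi, ← Real.exp_add]
  refine Real.exp_le_exp.2 ?_
  have h1 : -(r * c) ≤ C * |(r : ℝ)| := by
    refine (neg_le_abs _).trans ?_
    rw [abs_mul, mul_comm]
    gcongr
  have h2 : -(r * a.im) ≤ |a.im| * |(r : ℝ)| := by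
    refine (neg_le_abs _).trans ?_
    rw [abs_mul, mul_comm]
  have h3 : 0 < Real.pi / A := div_pos Real.pi_pos hA
  have h4 : -Real.pi * ((r : ℝ) + c) ^ 2 / A = Real.pi / A * (-((r : ℝ) + c) ^ 2) := by ring
  have h5 : 2 * Real.pi / A * C = Real.pi / A * (2 * C) := by ring
  rw [h4, h5]
  nlinarith [mul_le_mul_of_nonneg_left h1 h3.le, mul_le_mul_of_nonneg_left h2 Real.pi_pos.le,
    mul_nonneg h3.le (sq_nonneg c)]

lemma summable_errorSum {A : ℝ} (hA : 0 < A) (c : ℝ) (a : ℂ) :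
    Summable fun r : ℤ =>
      ((Real.sign ((r : ℝ) + 1 / 2) - E (((r : ℝ) + c) / √A) : ℝ) : ℂ) *
        cexp (2 * Real.pi * I * r * a) := by
  obtain ⟨K, hK⟩ := abs_sign_half_sub_E_le hA c
  have hK0 : 0 ≤ K := by
    by_contra! h
    have := (abs_nonneg _).trans (hK 0)
    have h2 := Real.exp_pos (-Real.pi * (((0 : ℤ) : ℝ) + c) ^ 2 / A)
    nlinarith
  refine summable_of_norm_le_exp_quadratic (K := K)
    (β := 2 * Real.pi / A * |c| + 2 * Real.pi * |a.im|) (γ := 0) (div_pos Real.pi_pos hA) fun r => ?_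
  rw [norm_mul, Complex.norm_real, Real.norm_eq_abs]
  refine (mul_le_mul_of_nonneg_right (hK r) (norm_nonneg _)).trans ?_
  rw [mul_assoc]
  exact mul_le_mul_of_nonneg_left (exp_shift_mul_le hA le_rfl a r) hK0

/-- The sign part does not depend on `c`, and `E` differentiates to a Gaussian: this is the dual
side of `tsum_gaussian_poisson`. -/
lemma hasDerivAt_errorSum {A : ℝ} (hA : 0 < A) (c : ℝ) (a : ℂ) :
    HasDerivAt (fun c => errorSum A c a)
      (-2 * (((√A)⁻¹ : ℝ) * ∑' r : ℤ, ((Real.exp (-Real.pi * ((r : ℝ) + c) ^ 2 / A) : ℝ) : ℂ) *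
        cexp (2 * Real.pi * I * r * a))) c := by
  rw [← tsum_mul_left, ← tsum_mul_left]
  unfold errorSum
  have hs : 0 < √A := Real.sqrt_pos.2 hA
  have hb := (summable_exp_quadratic (div_pos Real.pi_pos hA)
    (2 * Real.pi / A * (|c| + 1) + 2 * Real.pi * |a.im|) 0).mul_left (2 * (√A)⁻¹)
  refine hasDerivAt_tsum_of_unit_ball
    (g := fun (r : ℤ) (x : ℝ) =>
      ((Real.sign ((r : ℝ) + 1 / 2) - E (((r : ℝ) + x) / √A) : ℝ) : ℂ) *
        cexp (2 * Real.pi * I * r * a))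
    (g' := fun (r : ℤ) (x : ℝ) => -2 * (((√A)⁻¹ : ℝ) *
      (((Real.exp (-Real.pi * ((r : ℝ) + x) ^ 2 / A) : ℝ) : ℂ) * cexp (2 * Real.pi * I * r * a))))
    hb c (fun r x _ => ?_) (fun r x hx => ?_) (summable_errorSum hA c a)
  · have h1 : HasDerivAt (fun x : ℝ => ((r : ℝ) + x) / √A) (1 / √A) x :=
      ((hasDerivAt_id x).const_add _).div_const _
    have h2 := (((hasDerivAt_E _).comp x h1).const_sub
      (Real.sign ((r : ℝ) + 1 / 2))).ofReal_comp.mul_const (cexp (2 * Real.pi * I * r * a))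
    convert! h2 using 1
    rw [div_pow, Real.sq_sqrt hA.le]
    push_cast
    ring_nf
  · have hx' : |x| ≤ |c| + 1 := by linarith [abs_sub_abs_le_abs_sub x c]
    have h := exp_shift_mul_le hA hx' a r
    rw [norm_mul, norm_mul, norm_mul, Complex.norm_real, Complex.norm_real, Real.norm_eq_abs,
      Real.norm_eq_abs, Real.abs_exp, abs_of_pos (inv_pos.2 hs), norm_neg, Complex.norm_ofNat,
      ← mul_assoc]
    gcongr

lemma exp_two_pi_ne_one {a : ℂ} (ha : ∀ n : ℤ, a ≠ n) : cexp (2 * Real.pi * I * a) ≠ 1 := by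
  rw [Ne, Complex.exp_eq_one_iff]
  rintro ⟨n, hn⟩
  apply ha n
  have : (2 * Real.pi * I : ℂ) ≠ 0 := two_pi_I_ne_zero
  rw [mul_comm (n : ℂ)] at hn
  exact mul_left_cancel₀ this hn

lemma kernelSum_add_one (A c : ℝ) (a : ℂ) :
    kernelSum A (c + 1) a = cexp (-(2 * Real.pi * I * a)) * kernelSum A c a := by
  unfold kernelSum
  rw [← tsum_mul_left]
  refine tsum_congr fun n => ?_
  rw [← mul_div_assoc, ← Complex.exp_add]
  congr 1
  have h : -(Real.pi : ℂ) * A * (a + n) ^ 2 - 2 * Real.pi * I * ((c + 1 : ℝ) : ℂ) * (a + n) =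
      (-(2 * Real.pi * I * a) + (-Real.pi * A * (a + n) ^ 2 - 2 * Real.pi * I * c * (a + n))) +
        (-n : ℤ) * (2 * Real.pi * I) := by
    push_cast
    ring
  rw [h, Complex.exp_add _ ((-n : ℤ) * _), Complex.exp_int_mul_two_pi_mul_I, mul_one]

lemma sign_int_add_half (r : ℤ) :
    Real.sign (((r + 1 : ℤ) : ℝ) + 1 / 2) - Real.sign ((r : ℝ) + 1 / 2) =
      if r = -1 then 2 else 0 := by
  split_ifs with h
  · subst h
    rw [Real.sign_of_pos (by norm_num), Real.sign_of_neg (by norm_num)]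
    norm_num
  · rcases lt_or_gt_of_ne h with h | h
    · have h1 : (r : ℝ) ≤ -2 := by exact_mod_cast (by omega)
      rw [Real.sign_of_neg (by push_cast; linarith), Real.sign_of_neg (by linarith), sub_self]
    · have h1 : (0 : ℝ) ≤ r := by exact_mod_cast (by omega)
      rw [Real.sign_of_pos (by push_cast; linarith), Real.sign_of_pos (by linarith), sub_self]

/-- Replacing `c` by `c + 1` amounts to shifting `r`, except that the sign jumps by `2` at `r = -1`;
the jump is the source of the inhomogeneous term. -/
lemma errorSum_add_one {A : ℝ} (hA : 0 < A) (c : ℝ) (a : ℂ) :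
    errorSum A (c + 1) a = cexp (-(2 * Real.pi * I * a)) * (errorSum A c a - 2) := by
  have hshift : errorSum A c a = ∑' r : ℤ,
      ((Real.sign (((r + 1 : ℤ) : ℝ) + 1 / 2) - E ((((r + 1 : ℤ) : ℝ) + c) / √A) : ℝ) : ℂ) *
        cexp (2 * Real.pi * I * (r + 1 : ℤ) * a) :=
    ((Equiv.addRight (1 : ℤ)).tsum_eq fun r : ℤ =>
      ((Real.sign ((r : ℝ) + 1 / 2) - E (((r : ℝ) + c) / √A) : ℝ) : ℂ) *
        cexp (2 * Real.pi * I * r * a)).symm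
  have hsum := (summable_errorSum hA (c + 1) a).mul_left (cexp (2 * Real.pi * I * a))
  have hdelta : HasSum (fun r : ℤ => if r = -1 then (2 : ℂ) else 0) 2 := hasSum_ite_eq _ _
  have hX : cexp (2 * Real.pi * I * a) * errorSum A (c + 1) a + 2 = errorSum A c a := by
    rw [hshift]
    unfold errorSum
    have hadd := hsum.tsum_add hdelta.summable
    rw [hdelta.tsum_eq] at hadd
    rw [← tsum_mul_left, ← hadd]
    refine tsum_congr fun r => ?_
    have h1 : cexp (2 * Real.pi * I * (r + 1 : ℤ) * a) =
        cexp (2 * Real.pi * I * a) * cexp (2 * Real.pi * I * r * a) := by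
      rw [← Complex.exp_add]
      push_cast
      ring_nf
    have h2 := sign_int_add_half r
    have h3 : (((r + 1 : ℤ) : ℝ) + c) = (r : ℝ) + (c + 1) := by push_cast; ring
    rw [h1, h3]
    split_ifs with h
    · rw [if_pos h] at h2
      rw [show Real.sign (((r + 1 : ℤ) : ℝ) + 1 / 2) = 2 + Real.sign ((r : ℝ) + 1 / 2) by linarith]
      have h4 : cexp (2 * Real.pi * I * a) * cexp (2 * Real.pi * I * r * a) = 1 := by
        rw [← Complex.exp_add, ← Complex.exp_zero]
        subst h
        push_cast
        ring_nf
      push_cast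
      linear_combination (-2) * h4
    · rw [if_neg h] at h2
      rw [show Real.sign (((r + 1 : ℤ) : ℝ) + 1 / 2) = Real.sign ((r : ℝ) + 1 / 2) by linarith]
      ring
  rw [← hX, Complex.exp_neg]
  field_simp
  ring

/-- A partial fraction expansion with Gaussian convergence: the Appell kernel `1 / (1 - e^{2πia})`,
completed by error functions, is a sum over the poles. -/
theorem appell_kernel_eq {A : ℝ} (hA : 0 < A) (c : ℝ) {a : ℂ} (ha : ∀ n : ℤ, a ≠ n) :
    1 / (1 - cexp (2 * Real.pi * I * a)) - 1 / 2 * errorSum A c a =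
      I / (2 * Real.pi) * kernelSum A c a := by
  have hX := exp_two_pi_ne_one ha
  have hX1 : 1 - cexp (2 * Real.pi * I * a) ≠ 0 := sub_ne_zero.2 hX.symm
  set D : ℝ → ℂ := fun c => 1 / (1 - cexp (2 * Real.pi * I * a)) - 1 / 2 * errorSum A c a -
    I / (2 * Real.pi) * kernelSum A c a with hD
  have hderiv : ∀ c, HasDerivAt D 0 c := fun c => by
    have h := (((hasDerivAt_errorSum hA c a).const_mul (1 / 2 : ℂ)).const_sub
      (1 / (1 - cexp (2 * Real.pi * I * a)))).sub
        ((hasDerivAt_kernelSum hA c ha).const_mul (I / (2 * Real.pi)))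
    convert! h using 1
    rw [tsum_gaussian_poisson hA]
    have hpi : (Real.pi : ℂ) ≠ 0 := ofReal_ne_zero.2 Real.pi_ne_zero
    generalize (((√A)⁻¹ : ℝ) : ℂ) * ∑' r : ℤ, _ = T
    field_simp
    rw [I_sq]
    ring
  have hconst : D (c + 1) = D c :=
    is_const_of_deriv_eq_zero (fun x => (hderiv x).differentiableAt)
      (fun x => (hderiv x).deriv) _ _
  -- With `X = e^{2πia}`, the jump in `errorSum` adds `1/X` to `1/(1 - X)`, giving `X⁻¹ · 1/(1 -
  -- X)`, so the whole difference is quasi-periodic.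
  have hmul : D (c + 1) = cexp (-(2 * Real.pi * I * a)) * D c := by
    simp only [hD]
    rw [errorSum_add_one hA, kernelSum_add_one, Complex.exp_neg]
    field_simp
    ring
  rw [hconst, Complex.exp_neg] at hmul
  have h0 : D c = 0 := by
    have h1 : (cexp (2 * Real.pi * I * a) - 1) * D c = 0 := by
      have := congrArg (fun x => cexp (2 * Real.pi * I * a) * x) hmul
      rw [← mul_assoc, mul_inv_cancel₀ (Complex.exp_ne_zero _), one_mul] at this
      rw [sub_mul, this, one_mul, sub_self]
    exact (mul_eq_zero.1 h1).resolve_left (sub_ne_zero.2 hX)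
  exact sub_eq_zero.1 h0

end

/-! ### The lattice sum: convergence and differentiability -/

section

open Complex Metric

/-- Cauchy estimates on balls of half the radius turn a summable bound on the terms into one on
their derivatives. -/
lemma differentiableAt_tsum_of_norm_le {ι V : Type*} [NormedAddCommGroup V] [NormedSpace ℂ V]
    {F : ι → V → ℂ} {u : ι → ℝ} (hu : Summable u) {c : V} {ρ : ℝ} (hρ : 0 < ρ)
    (hd : ∀ i, DifferentiableOn ℂ (F i) (ball c ρ)) (hF : ∀ i, ∀ x ∈ ball c ρ, ‖F i x‖ ≤ u i) :
    DifferentiableAt ℂ (fun x => ∑' i, F i x) c := by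
  have hsub : ∀ x ∈ ball c (ρ / 2), ball x (ρ / 2) ⊆ ball c ρ := fun x hx =>
    ball_subset_ball' (by linarith [mem_ball.1 hx])
  have hmem : ∀ x ∈ ball c (ρ / 2), x ∈ ball c ρ := fun x hx =>
    hsub x hx (mem_ball_self (by linarith))
  have hbound : ∀ i, ∀ x ∈ ball c (ρ / 2), ‖fderiv ℂ (F i) x‖ ≤ (2 * u i) / (ρ / 2) := by
    intro i x hx
    refine norm_fderiv_le_div_of_mapsTo_ball ((hd i).mono (hsub x hx)) (fun y hy => ?_)
      (by linarith)
    rw [mem_closedBall, dist_eq_norm]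
    refine (norm_sub_le _ _).trans ?_
    linarith [hF i y (hsub x hx hy), hF i x (hmem x hx)]
  refine (hasFDerivAt_tsum_of_isPreconnected ((hu.mul_left 2).div_const (ρ / 2)) isOpen_ball
    (convex_ball c (ρ / 2) |>.isPreconnected)
    (fun i x hx => ((hd i).differentiableAt (isOpen_ball.mem_nhds (hmem x hx))).hasFDerivAt)
    hbound (mem_ball_self (by linarith)) ?_ (mem_ball_self (by linarith))).differentiableAt
  exact hu.of_norm_bounded fun i => hF i c (mem_ball_self hρ)

lemma le_norm_sq_lattice {τ : ℂ} (hτ : 0 < τ.im) :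
    ∃ κ > 0, ∀ l n : ℤ, κ * ((l : ℝ) ^ 2 + (n : ℝ) ^ 2) ≤ ‖(l : ℂ) * τ + n‖ ^ 2 := by
  have hden : 0 < τ.im ^ 2 * 2 + 1 + 2 * τ.re ^ 2 := by positivity
  -- The constant comes from `n² ≤ 2 (l Re τ + n)² + 2 (l Re τ)²`.
  refine ⟨τ.im ^ 2 / (τ.im ^ 2 * 2 + 1 + 2 * τ.re ^ 2), by positivity, fun l n => ?_⟩
  rw [div_mul_eq_mul_div, div_le_iff₀ hden, ← Complex.normSq_eq_norm_sq, Complex.normSq_apply]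
  simp only [add_re, add_im, mul_re, mul_im, intCast_re, intCast_im, zero_mul, sub_zero, add_zero]
  nlinarith [mul_nonneg (sq_nonneg τ.im) (sq_nonneg (2 * (l : ℝ) * τ.re + n)),
    sq_nonneg ((l : ℝ) * τ.re + n), mul_nonneg (sq_nonneg τ.re) (sq_nonneg ((l : ℝ) * τ.re + n)),
    sq_nonneg ((l : ℝ) * τ.im * τ.re), sq_nonneg ((l : ℝ) * τ.im ^ 2)]

lemma norm_lattice_le (τ : ℂ) (l n : ℤ) :
    ‖(l : ℂ) * τ + n‖ ≤ (‖τ‖ + 1) * (|(l : ℝ)| + |(n : ℝ)|) := by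
  refine (norm_add_le _ _).trans ?_
  rw [norm_mul, Complex.norm_intCast, Complex.norm_intCast]
  nlinarith [abs_nonneg (l : ℝ), abs_nonneg (n : ℝ), norm_nonneg τ,
    mul_nonneg (norm_nonneg τ) (abs_nonneg (n : ℝ))]

/-- Only finitely many translates of `z` lie in the unit disc, so the least of their norms, capped
by `1`, works. -/
lemma exists_le_norm_add_lattice {τ z : ℂ} (hτ : 0 < τ.im) (hz : ∀ r s : ℤ, z ≠ r + s * τ) :
    ∃ δ > 0, ∀ l n : ℤ, δ ≤ ‖z + (l * τ + n)‖ := by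
  obtain ⟨κ, hκ, hle⟩ := le_norm_sq_lattice hτ
  have hne : ∀ l n : ℤ, 0 < ‖z + (l * τ + n)‖ := fun l n => by
    rw [norm_pos_iff]
    intro h
    apply hz (-n) (-l)
    push_cast
    linear_combination h
  set S : Set (ℤ × ℤ) := {x | ‖z + (x.1 * τ + x.2)‖ < 1} with hS
  have hfin : S.Finite := by
    obtain ⟨K, hK⟩ := exists_nat_gt ((1 + ‖z‖) ^ 2 / κ)
    have hK' : (1 + ‖z‖) ^ 2 < K * κ := by rwa [div_lt_iff₀ hκ] at hK
    refine ((Set.finite_Icc (-K : ℤ) K).prod (Set.finite_Icc (-K : ℤ) K)).subset ?_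
    rintro ⟨l, n⟩ hx
    have h1 : ‖(l : ℂ) * τ + n‖ ≤ 1 + ‖z‖ := by
      have := norm_sub_le (z + (l * τ + n)) z
      rw [add_sub_cancel_left] at this
      have hx' : ‖z + (l * τ + n)‖ < 1 := hx
      linarith
    have h2 : ‖(l : ℂ) * τ + n‖ ^ 2 ≤ (1 + ‖z‖) ^ 2 := pow_le_pow_left₀ (norm_nonneg _) h1 2
    have h3 : (l : ℝ) ^ 2 + (n : ℝ) ^ 2 ≤ K := by
      have := hle l n
      by_contra! hlt
      nlinarith
    have h4 : l ^ 2 + n ^ 2 ≤ (K : ℤ) := by exact_mod_cast h3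
    refine ⟨⟨?_, ?_⟩, ⟨?_, ?_⟩⟩ <;> simp only <;> nlinarith [sq_nonneg l, sq_nonneg n]
  rcases S.eq_empty_or_nonempty with he | hn
  · refine ⟨1, one_pos, fun l n => ?_⟩
    by_contra! h
    exact (Set.eq_empty_iff_forall_notMem.1 he (l, n)) h
  · obtain ⟨x, -, hmin⟩ := Set.exists_min_image S (fun x => ‖z + (x.1 * τ + x.2)‖) hfin hn
    refine ⟨min 1 ‖z + (x.1 * τ + x.2)‖, lt_min one_pos (hne _ _), fun l n => ?_⟩
    by_cases h : (l, n) ∈ S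
    · exact (min_le_right 1 _).trans (hmin (l, n) h)
    · exact (min_le_left 1 _).trans (not_lt.1 h)

lemma summable_exp_quadratic_prod {α : ℝ} (hα : 0 < α) (β γ : ℝ) :
    Summable fun x : ℤ × ℤ => Real.exp (-α * ((x.1 : ℝ) ^ 2 + (x.2 : ℝ) ^ 2) +
      β * (|(x.1 : ℝ)| + |(x.2 : ℝ)|) + γ) := by
  have h1 := summable_exp_quadratic hα β 0
  have h2 := summable_exp_quadratic hα β γ
  have h3 := summable_mul_of_summable_norm h1.norm h2.norm
  refine h3.congr fun x => ?_
  rw [← Real.exp_add]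
  congr 1
  ring

/-- The general term of the lattice sum `appellSum`, with the conjugate variables replaced by an
independent variable, so that it is holomorphic. -/
def latticeTerm (N : ℕ) (τ : ℂ) (p : ℂ × ℂ × ℂ) (x : ℤ × ℤ) : ℂ :=
  cexp (2 * Real.pi * I * N * x.1 * p.2.1 - Real.pi * N / τ.im * (p.1 + (x.1 * τ + x.2)) *
    (p.2.2 + (x.1 * (starRingEnd ℂ) τ + x.2))) / (p.1 + (x.1 * τ + x.2))

/-- The completed Appell function of level `N` as an absolutely convergent sum over the lattice
`ℤτ + ℤ`. -/
def appellSum (N : ℕ) (τ z₁ z₂ : ℂ) : ℂ :=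
  I / (2 * Real.pi) * ∑' x : ℤ × ℤ,
    latticeTerm N τ (z₁, z₂, (starRingEnd ℂ) z₁ + z₂ - (starRingEnd ℂ) z₂) x

/-- With `ω = lτ + n`, the exponent is `-(πN / Im τ) |ω|²` plus terms growing at most linearly in
`l` and `n`, uniformly for bounded `p`. This domination serves both summability and termwise
differentiation. -/
lemma exists_latticeTerm_bound {N : ℕ} (hN : 0 < N) {τ : ℂ} (hτ : 0 < τ.im) {B δ : ℝ}
    (hB : 0 ≤ B) (hδ : 0 < δ) :
    ∃ u : ℤ × ℤ → ℝ, Summable u ∧ ∀ p : ℂ × ℂ × ℂ, ‖p‖ ≤ B → ∀ x : ℤ × ℤ,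
      δ ≤ ‖p.1 + (x.1 * τ + x.2)‖ → ‖latticeTerm N τ p x‖ ≤ u x := by
  obtain ⟨κ, hκ, hle⟩ := le_norm_sq_lattice hτ
  have hN' : (0 : ℝ) < N := by exact_mod_cast hN
  set A : ℝ := Real.pi * N / τ.im with hA
  have hA0 : 0 < A := by positivity
  refine ⟨fun x => Real.exp (-(A * κ) * ((x.1 : ℝ) ^ 2 + (x.2 : ℝ) ^ 2) +
    (2 * Real.pi * N * B + 2 * A * B * (‖τ‖ + 1)) * (|(x.1 : ℝ)| + |(x.2 : ℝ)|) +
      A * B ^ 2) / δ,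
    (summable_exp_quadratic_prod (mul_pos hA0 hκ) _ _).div_const δ, ?_⟩
  rintro ⟨z, v, s⟩ hp ⟨l, n⟩ hx
  have hz : ‖z‖ ≤ B := (norm_fst_le (z, v, s)).trans hp
  have hv : ‖v‖ ≤ B := ((norm_fst_le (v, s)).trans (norm_snd_le (z, v, s))).trans hp
  have hs : ‖s‖ ≤ B := ((norm_snd_le (v, s)).trans (norm_snd_le (z, v, s))).trans hp
  unfold latticeTerm
  simp only at hx ⊢
  rw [norm_div, Complex.norm_exp]
  refine div_le_div₀ (Real.exp_pos _).le (Real.exp_le_exp.2 ?_) hδ hx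
  set ω : ℂ := l * τ + n with hω
  have hconj : (l : ℂ) * (starRingEnd ℂ) τ + n = (starRingEnd ℂ) ω := by simp [hω]
  have hωle := norm_lattice_le τ l n
  have hωge := hle l n
  rw [← hω] at hωle hωge
  rw [hconj]
  have hexp : 2 * Real.pi * I * N * l * v -
      Real.pi * N / τ.im * (z + ω) * (s + (starRingEnd ℂ) ω) =
      2 * Real.pi * I * N * l * v - (A : ℂ) * (z * (starRingEnd ℂ) ω + s * ω + z * s) -
        ((A * ‖ω‖ ^ 2 : ℝ) : ℂ) := by
    rw [hA]
    push_cast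
    have := Complex.mul_conj' ω
    linear_combination (-(Real.pi * N / τ.im : ℂ)) * this
  rw [hexp, sub_re, ofReal_re]
  have h1 : (2 * Real.pi * I * N * l * v - (A : ℂ) * (z * (starRingEnd ℂ) ω + s * ω + z * s)).re ≤
      2 * Real.pi * N * |(l : ℝ)| * B + A * (B * ‖ω‖ + B * ‖ω‖ + B * B) := by
    refine (Complex.re_le_norm _).trans ((norm_sub_le _ _).trans (add_le_add ?_ ?_))
    · simp only [norm_mul, Complex.norm_ofNat, Complex.norm_real, Complex.norm_I,
        Complex.norm_natCast, Complex.norm_intCast, Real.norm_eq_abs, abs_of_pos Real.pi_pos,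
        mul_one]
      gcongr
    · rw [norm_mul, Complex.norm_real, Real.norm_eq_abs, abs_of_pos hA0]
      refine mul_le_mul_of_nonneg_left ((norm_add₃_le).trans ?_) hA0.le
      simp only [norm_mul, RCLike.norm_conj]
      gcongr
  have h2 : 2 * A * B * ‖ω‖ ≤ 2 * A * B * ((‖τ‖ + 1) * (|(l : ℝ)| + |(n : ℝ)|)) := by gcongr
  have h3 : A * (κ * ((l : ℝ) ^ 2 + (n : ℝ) ^ 2)) ≤ A * ‖ω‖ ^ 2 := by gcongr
  have h4 : 0 ≤ 2 * Real.pi * N * B * |(n : ℝ)| := by positivity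
  nlinarith

lemma summable_latticeTerm {N : ℕ} (hN : 0 < N) {τ : ℂ} (hτ : 0 < τ.im) {p : ℂ × ℂ × ℂ}
    (hp : ∀ r s : ℤ, p.1 ≠ r + s * τ) : Summable (latticeTerm N τ p) := by
  obtain ⟨δ, hδ, hle⟩ := exists_le_norm_add_lattice hτ hp
  obtain ⟨u, hu, hb⟩ := exists_latticeTerm_bound hN hτ (norm_nonneg p) hδ
  exact hu.of_norm_bounded fun x => hb p le_rfl x (hle x.1 x.2)

lemma differentiableAt_tsum_latticeTerm {N : ℕ} (hN : 0 < N) {τ : ℂ} (hτ : 0 < τ.im)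
    {p : ℂ × ℂ × ℂ} (hp : ∀ r s : ℤ, p.1 ≠ r + s * τ) :
    DifferentiableAt ℂ (fun p => ∑' x, latticeTerm N τ p x) p := by
  obtain ⟨δ, hδ, hle⟩ := exists_le_norm_add_lattice hτ hp
  obtain ⟨u, hu, hb⟩ := exists_latticeTerm_bound hN hτ (B := ‖p‖ + δ / 2) (by positivity)
    (half_pos hδ)
  have hge : ∀ (x : ℤ × ℤ), ∀ q ∈ ball p (δ / 2), δ / 2 ≤ ‖q.1 + (x.1 * τ + x.2)‖ := by
    intro x q hq
    have h1 : ‖p.1 - q.1‖ < δ / 2 := by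
      rw [← Prod.fst_sub]
      refine (norm_fst_le (p - q)).trans_lt ?_
      rwa [← dist_eq_norm, dist_comm]
    have h2 := norm_add_le (q.1 + (x.1 * τ + x.2)) (p.1 - q.1)
    rw [show q.1 + (x.1 * τ + x.2) + (p.1 - q.1) = p.1 + (x.1 * τ + x.2) by ring] at h2
    linarith [hle x.1 x.2]
  refine differentiableAt_tsum_of_norm_le hu (half_pos hδ) (fun x q hq => ?_)
    (fun x q hq => hb q ?_ x (hge x q hq))
  · have hne : q.1 + (x.1 * τ + x.2) ≠ 0 :=
      norm_pos_iff.1 ((half_pos hδ).trans_le (hge x q hq))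
    unfold latticeTerm
    refine DifferentiableAt.differentiableWithinAt ?_
    fun_prop (disch := exact hne)
  · have h1 : ‖q - p‖ < δ / 2 := by rwa [← dist_eq_norm]
    have h2 := norm_add_le p (q - p)
    rw [add_sub_cancel] at h2
    linarith

lemma differentiableAt_conj (z : ℂ) : DifferentiableAt ℝ (starRingEnd ℂ) z :=
  conjCLE.differentiableAt

/-- The lattice sum is real-differentiable in both variables away from its poles. -/
lemma differentiableAt_appellSum {N : ℕ} (hN : 0 < N) {τ z₁ z₂ : ℂ} (hτ : 0 < τ.im)
    (hz : ∀ r s : ℤ, z₁ ≠ r + s * τ) :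
    DifferentiableAt ℝ (fun p : ℂ × ℂ => appellSum N τ p.1 p.2) (z₁, z₂) := by
  have h1 : DifferentiableAt ℝ (fun p : ℂ × ℂ × ℂ => ∑' x, latticeTerm N τ p x)
      (z₁, z₂, (starRingEnd ℂ) z₁ + z₂ - (starRingEnd ℂ) z₂) :=
    (differentiableAt_tsum_latticeTerm hN hτ hz).restrictScalars ℝ
  have hc : ∀ w : ℂ, DifferentiableAt ℝ (starRingEnd ℂ) w := differentiableAt_conj
  have h2 : DifferentiableAt ℝ (fun p : ℂ × ℂ =>
      (p.1, p.2, (starRingEnd ℂ) p.1 + p.2 - (starRingEnd ℂ) p.2)) (z₁, z₂) := by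
    have hf : DifferentiableAt ℝ (fun p : ℂ × ℂ => (starRingEnd ℂ) p.1) (z₁, z₂) :=
      (hc z₁).comp (z₁, z₂) differentiableAt_fst
    have hs : DifferentiableAt ℝ (fun p : ℂ × ℂ => (starRingEnd ℂ) p.2) (z₁, z₂) :=
      (hc z₂).comp (z₁, z₂) differentiableAt_snd
    fun_prop
  exact (h1.comp (z₁, z₂) h2).const_mul _

end

/-! ### From the lattice sum to Appell functions, `R` and theta series -/

section

open Complex

lemma conj_eq_sub (z : ℂ) : (starRingEnd ℂ) z = z - 2 * z.im * I := by
  apply Complex.ext <;> simp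
  ring

/-- The theta series of degree `N` indexed by all integers. -/
def thetaTerm (N : ℕ) (s : ℤ) (τ z : ℂ) : ℂ :=
  qpow τ ((s : ℂ) ^ 2 / (4 * N)) * cexp (Real.pi * I * s * z)

lemma Theta_eq_tsum {N : ℕ} (hN : 0 < N) (j : ℤ) (τ z : ℂ) :
    Theta j N τ z = ∑' l : ℤ, thetaTerm N (j + 2 * N * l) τ z := by
  have hN' : (N : ℂ) ≠ 0 := by exact_mod_cast hN.ne'
  unfold Theta thetaTerm
  refine tsum_congr fun l => ?_
  congr 2
  · push_cast
    field_simp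
    ring
  · push_cast
    field_simp
    ring

lemma thetaTerm_neg (N : ℕ) (s : ℤ) (τ z : ℂ) : thetaTerm N (-s) τ z = thetaTerm N s τ (-z) := by
  unfold thetaTerm
  push_cast
  ring_nf

lemma Theta_neg {N : ℕ} (hN : 0 < N) (j : ℤ) (τ z : ℂ) :
    Theta (-j) N τ z = Theta j N τ (-z) := by
  rw [Theta_eq_tsum hN, Theta_eq_tsum hN, ← (Equiv.neg ℤ).tsum_eq]
  refine tsum_congr fun l => ?_
  rw [← thetaTerm_neg, Equiv.neg_apply]
  ring_nf

lemma Theta_add {N : ℕ} (hN : 0 < N) (j q : ℤ) (τ z : ℂ) :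
    Theta (j + 2 * N * q) N τ z = Theta j N τ z := by
  rw [Theta_eq_tsum hN, Theta_eq_tsum hN,
    ← (Equiv.addLeft q).tsum_eq fun l : ℤ => thetaTerm N (j + 2 * N * l) τ z]
  refine tsum_congr fun l => ?_
  rw [Equiv.coe_addLeft]
  ring_nf

lemma R_add (m : ℕ) (j q : ℤ) (τ v : ℂ) : R m (j + 2 * m * q) τ v = R m j τ v := by
  unfold R
  rw [← (Equiv.addLeft q).tsum_eq fun l : ℤ => RTerm m (j + 2 * m * l) τ v]
  refine tsum_congr fun l => ?_
  rw [Equiv.coe_addLeft]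
  ring_nf

lemma sign_neg_add_half {n : ℤ} (hn : n ≠ 0) :
    Real.sign (-(n : ℝ) + 1 / 2) = -Real.sign ((n : ℝ) + 1 / 2) := by
  rcases lt_or_gt_of_ne hn with h | h
  · have h1 : (n : ℝ) ≤ -1 := by exact_mod_cast (by omega)
    rw [Real.sign_of_pos (by linarith), Real.sign_of_neg (by linarith), neg_neg]
  · have h1 : (1 : ℝ) ≤ n := by exact_mod_cast h
    rw [Real.sign_of_neg (by linarith), Real.sign_of_pos (by linarith)]

lemma RTerm_neg (m : ℕ) {n : ℤ} (hn : n ≠ 0) (τ v : ℂ) :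
    RTerm m (-n) τ (-v) = -RTerm m n τ v := by
  unfold RTerm
  push_cast
  rw [neg_im, sign_neg_add_half hn, show (-(n : ℝ) + 2 * m * (-v.im / τ.im)) * √(τ.im / m) =
    -(((n : ℝ) + 2 * m * (v.im / τ.im)) * √(τ.im / m)) by ring, E_neg]
  push_cast
  ring_nf

/-- Termwise oddness fails only at `n = 0`, where `sign (1/2)` does not change; so the class of `0`
must be excluded. -/
lemma R_neg (m : ℕ) {j : ℤ} (hj : ¬ (2 * m : ℤ) ∣ j) (τ v : ℂ) :
    R m (-j) τ (-v) = -R m j τ v := by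
  unfold R
  rw [← tsum_neg, ← (Equiv.neg ℤ).tsum_eq]
  refine tsum_congr fun l => ?_
  rw [← RTerm_neg]
  · rw [Equiv.neg_apply]
    ring_nf
  · intro h
    exact hj ⟨-l, by linarith⟩

/-- The theta difference vanishes for `j = 0`, exactly where `R_neg` is unavailable; for the other
classes `j ↦ -j` changes the sign of both factors. -/
lemma sum_R_mul_Theta_neg (m : ℕ) (τ v z : ℂ) :
    ∑ j ∈ Finset.range (2 * m + 2), R (m + 1) j τ (-v) *
        (Theta j (m + 1) τ z - Theta (-(j : ℤ)) (m + 1) τ z) =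
      ∑ j ∈ Finset.range (2 * m + 2), R (m + 1) j τ v *
        (Theta j (m + 1) τ z - Theta (-(j : ℤ)) (m + 1) τ z) := by
  rw [Finset.sum_range_succ', Finset.sum_range_succ' _ (2 * m + 1)]
  simp only [Nat.cast_zero, neg_zero, sub_self, mul_zero, add_zero]
  rw [← Finset.sum_range_reflect]
  refine Finset.sum_congr rfl fun i hi => ?_
  have hi' : i < 2 * m + 1 := Finset.mem_range.1 hi
  have hc : ((2 * m + 1 - 1 - i + 1 : ℕ) : ℤ) = -((i + 1 : ℕ) : ℤ) + 2 * (m + 1 : ℕ) * 1 := by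
    push_cast
    omega
  have hc' : -((2 * m + 1 - 1 - i + 1 : ℕ) : ℤ) = ((i + 1 : ℕ) : ℤ) + 2 * (m + 1 : ℕ) * (-1) := by
    push_cast
    omega
  have hnd : ¬ (2 * (m + 1 : ℕ) : ℤ) ∣ ((i + 1 : ℕ) : ℤ) := by
    intro h
    have := Int.le_of_dvd (by positivity) h
    push_cast at this
    omega
  rw [hc', Theta_add (Nat.succ_pos m), hc, Theta_add (Nat.succ_pos m), R_add, R_neg _ hnd]
  ring

lemma norm_thetaTerm {N : ℕ} (s : ℤ) (τ z : ℂ) :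
    ‖thetaTerm N s τ z‖ =
      Real.exp (-(Real.pi * τ.im / (2 * N)) * (s : ℝ) ^ 2 - Real.pi * s * z.im) := by
  unfold thetaTerm qpow
  rw [← Complex.exp_add, Complex.norm_exp]
  congr 1
  have h : 2 * Real.pi * I * ((s : ℂ) ^ 2 / (4 * N)) * τ + Real.pi * I * s * z =
      ((Real.pi * s ^ 2 / (2 * N) : ℝ) : ℂ) * (I * τ) + ((Real.pi * s : ℝ) : ℂ) * (I * z) := by
    push_cast
    ring
  rw [h, add_re, re_ofReal_mul, re_ofReal_mul, I_mul_re, I_mul_re]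
  ring

lemma summable_thetaTerm {N : ℕ} (hN : 0 < N) {τ : ℂ} (hτ : 0 < τ.im) (z : ℂ) :
    Summable fun s : ℤ => thetaTerm N s τ z := by
  have hN' : (0 : ℝ) < N := by exact_mod_cast hN
  refine summable_of_norm_le_exp_quadratic (α := Real.pi * τ.im / (2 * N))
    (β := Real.pi * |z.im|) (γ := 0) (K := 1) (by have := Real.pi_pos; positivity) fun s => ?_
  rw [norm_thetaTerm, one_mul]
  refine Real.exp_le_exp.2 ?_
  have h : -(s * z.im) ≤ |z.im| * |(s : ℝ)| := by
    rw [mul_comm, ← abs_mul]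
    exact neg_le_abs _
  nlinarith [mul_le_mul_of_nonneg_left h Real.pi_pos.le]

lemma RTerm_coeff {N : ℕ} (hN : 0 < N) (τ : ℂ) (n : ℤ) (v : ℂ) :
    ((n : ℝ) + 2 * N * (v.im / τ.im)) * √(τ.im / N) =
      ((n : ℝ) + N / τ.im * (2 * v.im)) / √(N / τ.im) := by
  have hN' : (0 : ℝ) < N := by exact_mod_cast hN
  rw [div_eq_mul_inv _ (√(N / τ.im)), ← Real.sqrt_inv, inv_div]
  ring

/-- The exponential grows like `e^{π n² Im τ / (2N)}`, but the sign-minus-`E` factor decays at twice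
that rate; half of the decay remains. -/
lemma summable_RTerm {N : ℕ} (hN : 0 < N) {τ : ℂ} (hτ : 0 < τ.im) (v : ℂ) :
    Summable fun r : ℤ => RTerm N r τ v := by
  have hN' : (0 : ℝ) < N := by exact_mod_cast hN
  set A : ℝ := N / τ.im with hA
  have hA0 : 0 < A := div_pos hN' hτ
  set c : ℝ := A * (2 * v.im) with hc
  obtain ⟨K, hK⟩ := abs_sign_half_sub_E_le hA0 c
  refine summable_of_norm_le_exp_quadratic (α := Real.pi / (2 * A))
    (β := 2 * Real.pi / A * |c| + 2 * Real.pi * |v.im|) (γ := 0) (K := |K|)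
    (by have := Real.pi_pos; positivity) fun r => ?_
  unfold RTerm
  rw [RTerm_coeff hN, norm_mul, Complex.norm_real, Real.norm_eq_abs]
  refine (mul_le_mul_of_nonneg_right ((hK r).trans (mul_le_mul_of_nonneg_right (le_abs_self K)
    (Real.exp_pos _).le)) (norm_nonneg _)).trans ?_
  rw [mul_assoc]
  refine mul_le_mul_of_nonneg_left ?_ (abs_nonneg K)
  have hexp : -(Real.pi * I * (r : ℂ) ^ 2 / (2 * N) * τ) - 2 * Real.pi * I * r * v =
      ((-(Real.pi * r ^ 2 / (2 * N)) : ℝ) : ℂ) * (I * τ) +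
        ((-(2 * Real.pi * r) : ℝ) : ℂ) * (I * v) := by
    push_cast
    ring
  rw [Complex.norm_exp, hexp, add_re, re_ofReal_mul, re_ofReal_mul, I_mul_re, I_mul_re,
    ← Real.exp_add]
  refine Real.exp_le_exp.2 ?_
  have h1 : -(r * c) ≤ |c| * |(r : ℝ)| := by
    rw [mul_comm, ← abs_mul]
    exact neg_le_abs _
  have h2 : r * v.im ≤ |v.im| * |(r : ℝ)| := by
    rw [mul_comm, ← abs_mul]
    exact le_abs_self _
  have h3 : 0 < Real.pi / A := div_pos Real.pi_pos hA0
  have h4 : -Real.pi * ((r : ℝ) + c) ^ 2 / A = Real.pi / A * (-((r : ℝ) + c) ^ 2) := by ring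
  have h5 : Real.pi * (r : ℝ) ^ 2 / (2 * N) * τ.im = Real.pi / A * (r ^ 2 / 2) := by
    rw [hA]
    field_simp
  have h6 : Real.pi / (2 * A) = Real.pi / A * (1 / 2) := by field_simp
  have h7 : 2 * Real.pi / A = Real.pi / A * 2 := by ring
  rw [h4, h6, h7]
  nlinarith [mul_le_mul_of_nonneg_left h1 h3.le, mul_le_mul_of_nonneg_left h2 Real.pi_pos.le,
    mul_nonneg h3.le (sq_nonneg c)]

lemma summable_mul_shear {f g : ℤ → ℂ} (hf : Summable f) (hg : Summable g) {k : ℤ} (hk : k ≠ 0) :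
    Summable fun x : ℤ × ℤ => f x.2 * g (x.2 + k * x.1) := by
  have hinj : Function.Injective fun x : ℤ × ℤ => (x.2, x.2 + k * x.1) := by
    intro x x' hx
    have h1 : x.2 = x'.2 := congrArg Prod.fst hx
    have h2 : x.2 + k * x.1 = x'.2 + k * x'.1 := congrArg Prod.snd hx
    rw [h1] at h2
    exact Prod.ext (mul_left_cancel₀ hk (add_left_cancel h2)) h1
  have h := summable_mul_of_summable_norm hf.norm hg.norm
  have h2 : Summable ((fun x : ℤ × ℤ => f x.1 * g x.2) ∘ fun x : ℤ × ℤ => (x.2, x.2 + k * x.1)) :=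
    Summable.comp_injective h hinj
  simpa only [Function.comp_def] using h2

lemma tsum_int_eq_sum_range {n : ℕ} (hn : 0 < n) {F : ℤ → ℂ} (hF : Summable F) :
    ∑' r : ℤ, F r = ∑ j ∈ Finset.range n, ∑' q : ℤ, F (j + n * q) := by
  have : NeZero n := ⟨hn.ne'⟩
  set e : Fin n × ℤ ≃ ℤ := (Equiv.prodComm _ _).trans (Int.divModEquiv n).symm with he
  have h2 : Summable fun x => F (e x) := e.summable_iff.2 hF
  rw [← e.tsum_eq F, h2.tsum_prod, tsum_fintype, Finset.sum_range]
  refine Finset.sum_congr rfl fun j _ => tsum_congr fun q => ?_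
  have hq : e (j, q) = (j : ℕ) + n * q := by
    simp [he, Int.divModEquiv]
    ring
  rw [hq]

lemma summable_RTerm_mul_thetaTerm {N : ℕ} (hN : 0 < N) {τ : ℂ} (hτ : 0 < τ.im) (v z : ℂ) :
    Summable fun x : ℤ × ℤ => RTerm N x.2 τ v * thetaTerm N (x.2 + 2 * N * x.1) τ z :=
  summable_mul_shear (f := fun r => RTerm N r τ v) (g := fun s => thetaTerm N s τ z)
    (summable_RTerm hN hτ v) (summable_thetaTerm hN hτ z) (by positivity)

/-- Summing over `l` first gives `Theta r`, which depends only on `r` mod `2N`; grouping `r` by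
residue then collects `R`. -/
lemma tsum_RTerm_mul_thetaTerm {N : ℕ} (hN : 0 < N) {τ : ℂ} (hτ : 0 < τ.im) (v z : ℂ) :
    ∑' l : ℤ, ∑' r : ℤ, RTerm N r τ v * thetaTerm N (r + 2 * N * l) τ z =
      ∑ j ∈ Finset.range (2 * N), R N j τ v * Theta j N τ z := by
  have hs := summable_RTerm_mul_thetaTerm hN hτ v z
  rw [← Summable.tsum_comm
    (f := fun l r => RTerm N r τ v * thetaTerm N (r + 2 * N * l) τ z) hs]
  simp_rw [tsum_mul_left, ← Theta_eq_tsum hN]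
  have hsum : Summable fun r : ℤ => RTerm N r τ v * Theta r N τ z := by
    refine hs.prod_symm.prod.congr fun r => ?_
    simp only [Prod.swap, tsum_mul_left, ← Theta_eq_tsum hN]
  rw [tsum_int_eq_sum_range (n := 2 * N) (by omega) hsum]
  refine Finset.sum_congr rfl fun j _ => ?_
  unfold R
  rw [← tsum_mul_right]
  refine tsum_congr fun q => ?_
  push_cast
  rw [Theta_add hN]

/-- The general term of the Appell function of level `N`. -/
def appellTerm (N : ℕ) (τ z₁ z₂ : ℂ) (l : ℤ) : ℂ :=
  cexp (2 * Real.pi * I * l * N * (z₁ + z₂)) * qpow τ ((l : ℂ) ^ 2 * N) /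
    (1 - cexp (2 * Real.pi * I * z₁) * qpow τ l)

lemma tsum_latticeTerm_row {N : ℕ} {τ : ℂ} (hτ : 0 < τ.im) (z₁ z₂ : ℂ) (l : ℤ) :
    ∑' n : ℤ, latticeTerm N τ (z₁, z₂, (starRingEnd ℂ) z₁ + z₂ - (starRingEnd ℂ) z₂) (l, n) =
      cexp (2 * Real.pi * I * l * N * (z₁ + z₂)) * qpow τ ((l : ℂ) ^ 2 * N) *
        kernelSum (N / τ.im) (N / τ.im * (z₂.im - z₁.im)) (z₁ + l * τ) := by
  have hy : (τ.im : ℂ) ≠ 0 := ofReal_ne_zero.2 hτ.ne'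
  unfold kernelSum
  rw [← tsum_mul_left]
  refine tsum_congr fun n => ?_
  unfold latticeTerm qpow
  simp only
  rw [← add_assoc z₁, ← mul_div_assoc, ← Complex.exp_add, ← Complex.exp_add]
  congr 1
  -- Replacing conjugates by `z - 2i Im z` produces `2πiNl (z₁ + lτ + n)`, whose last part is an
  -- integer multiple of `2πi`.
  refine Complex.exp_eq_exp_iff_exists_int.2 ⟨N * l * n, ?_⟩
  rw [conj_eq_sub z₁, conj_eq_sub z₂, conj_eq_sub τ]
  push_cast
  field_simp
  ring

/-- The `r²` terms in the two exponents cancel, leaving something linear in `r`: a term of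
`errorSum` at `a = z₁ + lτ`. -/
lemma RTerm_mul_thetaTerm {N : ℕ} (hN : 0 < N) (τ z₁ z₂ : ℂ) (l r : ℤ) :
    RTerm N r τ ((z₂ - z₁) / 2) * thetaTerm N (r + 2 * N * l) τ (z₁ + z₂) =
      cexp (2 * Real.pi * I * l * N * (z₁ + z₂)) * qpow τ ((l : ℂ) ^ 2 * N) *
        (((Real.sign ((r : ℝ) + 1 / 2) -
          E (((r : ℝ) + N / τ.im * (z₂.im - z₁.im)) / √(N / τ.im)) : ℝ) : ℂ) *
            cexp (2 * Real.pi * I * r * (z₁ + l * τ))) := by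
  have hN' : (N : ℂ) ≠ 0 := by exact_mod_cast hN.ne'
  have him : 2 * ((z₂ - z₁) / 2).im = z₂.im - z₁.im := by
    rw [show ((z₂ - z₁) / 2).im = (z₂ - z₁).im / 2 by simp,
      sub_im]
    ring
  unfold RTerm thetaTerm qpow
  rw [RTerm_coeff hN, him]
  generalize ((Real.sign ((r : ℝ) + 1 / 2) - _ : ℝ) : ℂ) = S
  have key : cexp (-(Real.pi * I * (r : ℂ) ^ 2 / (2 * N) * τ) -
        2 * Real.pi * I * r * ((z₂ - z₁) / 2)) *
      (cexp (2 * Real.pi * I * (((r + 2 * N * l : ℤ) : ℂ) ^ 2 / (4 * N)) * τ) *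
        cexp (Real.pi * I * ((r + 2 * N * l : ℤ) : ℂ) * (z₁ + z₂))) =
      cexp (2 * Real.pi * I * l * N * (z₁ + z₂)) * cexp (2 * Real.pi * I * ((l : ℂ) ^ 2 * N) * τ) *
        cexp (2 * Real.pi * I * r * (z₁ + l * τ)) := by
    rw [← Complex.exp_add, ← Complex.exp_add, ← Complex.exp_add, ← Complex.exp_add]
    congr 1
    push_cast
    field_simp
    ring
  linear_combination S * key

lemma hasSum_appellTerm {N : ℕ} (hN : 0 < N) {τ : ℂ} (hτ : 0 < τ.im) {z₁ z₂ : ℂ}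
    (hz : ∀ r s : ℤ, z₁ ≠ r + s * τ) :
    HasSum (appellTerm N τ z₁ z₂) (appellSum N τ z₁ z₂ +
      1 / 2 * ∑ j ∈ Finset.range (2 * N), R N j τ ((z₂ - z₁) / 2) * Theta j N τ (z₁ + z₂)) := by
  have hN' : (0 : ℝ) < N := by exact_mod_cast hN
  have hsL := summable_latticeTerm hN hτ
    (p := (z₁, z₂, (starRingEnd ℂ) z₁ + z₂ - (starRingEnd ℂ) z₂)) hz
  have h1 := (hsL.prod.hasSum).mul_left (I / (2 * Real.pi))
  rw [← hsL.tsum_prod] at h1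
  have h2 := ((summable_RTerm_mul_thetaTerm hN hτ ((z₂ - z₁) / 2)
    (z₁ + z₂)).prod.hasSum).mul_left (1 / 2)
  rw [tsum_RTerm_mul_thetaTerm hN hτ] at h2
  convert! h1.add h2 using 1
  funext l
  have ha : ∀ n : ℤ, z₁ + l * τ ≠ n := fun n h => hz n (-l) (by
    push_cast
    linear_combination h)
  have hk := appell_kernel_eq (div_pos hN' hτ) (N / τ.im * (z₂.im - z₁.im)) ha
  have hX : cexp (2 * Real.pi * I * (z₁ + l * τ)) = cexp (2 * Real.pi * I * z₁) * qpow τ l := by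
    unfold qpow
    rw [← Complex.exp_add]
    ring_nf
  simp only [tsum_latticeTerm_row hτ, RTerm_mul_thetaTerm hN, tsum_mul_left]
  rw [← errorSum]
  unfold appellTerm
  rw [hX] at hk
  rw [div_eq_mul_one_div, sub_eq_iff_eq_add.1 hk]
  ring

/-- The second fraction in `Phi` is the first one at `(-z₂, -z₁)`. This swap fixes `z₂ - z₁` and
negates `z₁ + z₂`, so both corrections share `R` and the theta series combine into `Theta j - Theta
(-j)`. -/
lemma PhiTilde_eq_appellSum (m : ℕ) {τ : ℂ} (hτ : 0 < τ.im) {z₁ z₂ : ℂ} (t : ℂ)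
    (hz₁ : ∀ r s : ℤ, z₁ ≠ r + s * τ) (hz₂ : ∀ r s : ℤ, z₂ ≠ r + s * τ) :
    PhiTilde m τ z₁ z₂ t = cexp (2 * Real.pi * I * (m + 1) * t) *
      (appellSum (m + 1) τ z₁ z₂ - appellSum (m + 1) τ (-z₂) (-z₁)) := by
  have hz₂' : ∀ r s : ℤ, -z₂ ≠ r + s * τ := fun r s h => hz₂ (-r) (-s) (by
    push_cast
    linear_combination -h)
  have h1 := hasSum_appellTerm (Nat.succ_pos m) hτ (z₂ := z₂) hz₁
  have h2 := hasSum_appellTerm (Nat.succ_pos m) hτ (z₂ := -z₁) hz₂'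
  unfold PhiTilde PhiAdd Phi
  have h3 := (h1.sub h2).tsum_eq
  have h4 : ∀ j : ℤ, appellTerm (m + 1) τ z₁ z₂ j - appellTerm (m + 1) τ (-z₂) (-z₁) j =
      (cexp (2 * Real.pi * I * j * (m + 1) * (z₁ + z₂)) * qpow τ ((j : ℂ) ^ 2 * (m + 1)) /
          (1 - cexp (2 * Real.pi * I * z₁) * qpow τ j) -
        cexp (-(2 * Real.pi * I * j * (m + 1) * (z₁ + z₂))) * qpow τ ((j : ℂ) ^ 2 * (m + 1)) /
          (1 - cexp (-(2 * Real.pi * I * z₂)) * qpow τ j)) := fun j => by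
    unfold appellTerm
    push_cast
    ring_nf
  simp_rw [Nat.succ_eq_add_one, h4] at h3
  rw [h3, show (z₁ - z₂) / 2 = -((z₂ - z₁) / 2) by ring, sum_R_mul_Theta_neg,
    show (-z₁ - -z₂) / 2 = (z₂ - z₁) / 2 by ring, show -z₂ + -z₁ = -(z₁ + z₂) by ring,
    show 2 * (m + 1) = 2 * m + 2 by ring]
  simp_rw [← Theta_neg (Nat.succ_pos m), mul_sub, Finset.sum_sub_distrib]
  ring

end

/-! ### Inversion of the twisted lattice sum -/

section

open Complex

lemma tsum_int_eq_sum_zmod {M : ℕ} [NeZero M] {r : ZMod M → ℤ}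
    (hr : ∀ x, ((r x : ℤ) : ZMod M) = x) {F : ℤ → ℂ} (hF : Summable F) :
    ∑' a : ℤ, F a = ∑ x : ZMod M, ∑' l : ℤ, F (r x + M * l) := by
  have hM : (M : ℤ) ≠ 0 := by exact_mod_cast NeZero.ne M
  have hbij : Function.Bijective fun p : ZMod M × ℤ => r p.1 + M * p.2 := by
    constructor
    · intro p q h
      have h' : r p.1 + M * p.2 = r q.1 + M * q.2 := h
      have h1 : p.1 = q.1 := by
        have := congrArg (fun a : ℤ => (a : ZMod M)) h'
        simpa [hr] using this
      rw [h1] at h'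
      exact Prod.ext h1 (mul_left_cancel₀ hM (add_left_cancel h'))
    · intro a
      have hd : (M : ℤ) ∣ a - r (a : ZMod M) := by
        rw [← ZMod.intCast_zmod_eq_zero_iff_dvd]
        simp [hr]
      obtain ⟨l, hl⟩ := hd
      exact ⟨((a : ZMod M), l), by simp only; linarith⟩
  set e : ZMod M × ℤ ≃ ℤ := Equiv.ofBijective _ hbij with he
  have h2 : Summable fun p => F (e p) := e.summable_iff.2 hF
  rw [← e.tsum_eq F, h2.tsum_prod, tsum_fintype]
  rfl

/-- Orthogonality of characters gives the condition `M ∣ N d`; coprimality reduces it to `M ∣ d`. -/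
lemma sum_zmod_exp {M N : ℕ} [NeZero M] (hcop : Nat.Coprime N M) {s : ZMod M → ℤ}
    (hs : ∀ y, ((s y : ℤ) : ZMod M) = y) (ε : ℂ) (d : ℤ) :
    ∑ y : ZMod M, cexp (-(2 * Real.pi * I * N / M * ((ε + s y) * d))) =
      if (M : ℤ) ∣ d then M * cexp (-(2 * Real.pi * I * N / M * (ε * d))) else 0 := by
  have h1 : ∀ y : ZMod M, cexp (-(2 * Real.pi * I * N / M * ((ε + s y) * d))) =
      cexp (-(2 * Real.pi * I * N / M * (ε * d))) *
        ZMod.stdAddChar (y * ((-(N * d) : ℤ) : ZMod M)) := fun y => by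
    have h2 : y * ((-(N * d) : ℤ) : ZMod M) = ((s y * -(N * d) : ℤ) : ZMod M) := by
      rw [Int.cast_mul, hs]
    rw [h2, ZMod.stdAddChar_coe, ← Complex.exp_add]
    congr 1
    push_cast
    ring
  simp_rw [h1]
  rw [← Finset.mul_sum, AddChar.sum_mulShift _ (ZMod.isPrimitive_stdAddChar M)]
  have h3 : (((-(N * d) : ℤ) : ZMod M) = 0) ↔ (M : ℤ) ∣ d := by
    rw [ZMod.intCast_zmod_eq_zero_iff_dvd, dvd_neg]
    exact ⟨fun h => (Nat.isCoprime_iff_coprime.2 hcop.symm).dvd_of_dvd_mul_left h,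
      fun h => h.mul_left _⟩
  simp only [h3, ZMod.card]
  split_ifs <;> simp [mul_comm]

/-- The summand common to both sides of the modular transformation of `appellPsi`. -/
def pairedTerm (M N : ℕ) (τ z₁ z₂ k α ν : ℂ) : ℂ :=
  cexp (2 * Real.pi * I * N / M * α * (z₂ - k) - Real.pi * N / (M * τ.im) * (z₁ + α * τ + ν) *
    ((starRingEnd ℂ) z₁ + α * (starRingEnd ℂ) τ + ν + z₂ - (starRingEnd ℂ) z₂)) /
      (z₁ + α * τ + ν)

/-- The completed Appell function of level `N` twisted at the modulus `Mτ`. -/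
def appellPsi (M N : ℕ) (ε j k τ z₁ z₂ : ℂ) : ℂ :=
  qpow τ (N * j * k / M) * cexp (2 * Real.pi * I * N / M * (k * z₁ + j * z₂)) *
    appellSum N (M * τ) (z₁ + j * τ + ε) (z₂ + k * τ + ε)

/-- All dependence on `b` is isolated in a character of `b`, so the sum over `b` can be carried out
before the lattice sum. Integrality of `k + ε'` makes the leftover phase trivial. -/
lemma latticeTerm_eq_pairedTerm {M : ℕ} [NeZero M] (N : ℕ) {τ : ℂ} (hτ : 0 < τ.im)
    (z₁ z₂ : ℂ) (ε' a b j k : ℝ) {K d : ℤ} (hk : k + ε' = K) (l n : ℤ) (hd : n + ε' + j = d) :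
    cexp (-(2 * Real.pi * I * N / M * (a * k + b * j))) *
      (qpow τ (N * a * b / M) * cexp (2 * Real.pi * I * N / M * (b * z₁ + a * z₂)) *
        latticeTerm N (M * τ) (z₁ + a * τ + ε', z₂ + b * τ + ε',
          (starRingEnd ℂ) (z₁ + a * τ + ε') + (z₂ + b * τ + ε') -
            (starRingEnd ℂ) (z₂ + b * τ + ε')) (l, n)) =
      pairedTerm M N τ z₁ z₂ k (a + M * l) (n + ε') *
        cexp (-(2 * Real.pi * I * N / M * (b * d))) := by
  have hM : (M : ℂ) ≠ 0 := by exact_mod_cast NeZero.ne M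
  have hy : (τ.im : ℂ) ≠ 0 := ofReal_ne_zero.2 hτ.ne'
  have him : (((M : ℂ) * τ).im : ℂ) = M * τ.im := by simp
  have hw : z₁ + a * τ + ε' + (l * (M * τ) + n) = z₁ + (a + M * l) * τ + (n + ε') := by ring
  have hd' : (d : ℂ) = n + ε' + j := by exact_mod_cast hd.symm
  have hk' : (k : ℂ) = K - ε' := by
    rw [eq_sub_iff_add_eq]
    exact_mod_cast hk
  unfold latticeTerm pairedTerm qpow
  simp only [map_add, map_mul, conj_ofReal, Complex.conj_natCast]
  rw [him, hw]
  have aux : ∀ {a b c d e f W : ℂ}, a * (b * c * d) = e * f →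
      a * (b * c * (d / W)) = e / W * f := fun h => by
    rw [div_mul_eq_mul_div, ← h]
    ring
  refine aux ?_
  rw [← Complex.exp_add, ← Complex.exp_add, ← Complex.exp_add, ← Complex.exp_add]
  refine Complex.exp_eq_exp_iff_exists_int.2 ⟨N * l * K, ?_⟩
  rw [conj_eq_sub τ, hd', hk']
  push_cast
  field_simp
  ring

/-- The denominator at `-1/τ` is a lattice denominator for `τ` divided by `τ`, with the roles of `l`
and `n` exchanged; this division is the source of weight one. -/
lemma latticeTerm_inv_eq_pairedTerm {M : ℕ} [NeZero M] (N : ℕ) {τ : ℂ} (hτ : 0 < τ.im)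
    (z₁ z₂ : ℂ) (ε j k : ℝ) (l n : ℤ) :
    cexp (-(2 * Real.pi * I * N / M * (z₁ * z₂ / τ))) *
      (qpow (-1 / τ) (N * j * k / M) *
        cexp (2 * Real.pi * I * N / M * (k * (z₁ / τ) + j * (z₂ / τ))) *
        latticeTerm N (M * (-1 / τ)) (z₁ / τ + j * (-1 / τ) + ε, z₂ / τ + k * (-1 / τ) + ε,
          (starRingEnd ℂ) (z₁ / τ + j * (-1 / τ) + ε) + (z₂ / τ + k * (-1 / τ) + ε) -
            (starRingEnd ℂ) (z₂ / τ + k * (-1 / τ) + ε)) (l, n)) =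
      τ * (cexp (2 * Real.pi * I * N * ε * l) *
        pairedTerm M N τ z₁ z₂ k (ε + n) (-j - M * l)) := by
  have hM : (M : ℂ) ≠ 0 := by exact_mod_cast NeZero.ne M
  have hy : (τ.im : ℂ) ≠ 0 := ofReal_ne_zero.2 hτ.ne'
  have hτ0 : τ ≠ 0 := fun h => by simp [h] at hτ
  have hT0 : (starRingEnd ℂ) τ ≠ 0 := (map_ne_zero _).2 hτ0
  have him : (((M : ℂ) * (-1 / τ)).im : ℂ) = M * τ.im / (τ * (starRingEnd ℂ) τ) := by
    rw [Complex.mul_conj, neg_div, one_div, mul_neg, neg_im, ← ofReal_natCast, im_ofReal_mul,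
      Complex.inv_im]
    push_cast
    ring
  have hw : z₁ / τ + j * (-1 / τ) + ε + (l * (M * (-1 / τ)) + n) =
      (z₁ + (ε + n) * τ + (-j - M * l)) / τ := by
    field_simp
    ring
  unfold latticeTerm pairedTerm qpow
  simp only [map_add, map_mul, map_div₀, map_neg, map_one, conj_ofReal, Complex.conj_natCast]
  rw [him, hw]
  have aux : ∀ {a b c d e f W : ℂ}, a * (b * c * d) = e * f →
      a * (b * c * (d / (W / τ))) = τ * (e * (f / W)) := fun {a b c d e f W} h => by
    rw [← mul_div_assoc e, ← h, div_div_eq_mul_div]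
    ring
  refine aux ?_
  rw [← Complex.exp_add, ← Complex.exp_add, ← Complex.exp_add, ← Complex.exp_add]
  congr 1
  have hT : (τ.im : ℂ) = (τ - (starRingEnd ℂ) τ) / (2 * I) := by
    rw [conj_eq_sub τ]
    field_simp
    ring
  have hne : τ - (starRingEnd ℂ) τ ≠ 0 := fun h => hy (by rw [hT, h, zero_div])
  rw [hT]
  field_simp
  ring

lemma im_natCast_mul_pos {M : ℕ} (hM : 0 < M) {τ : ℂ} (hτ : 0 < τ.im) :
    0 < ((M : ℂ) * τ).im := by
  rw [← ofReal_natCast, im_ofReal_mul]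
  positivity

lemma im_natCast_mul_inv_pos {M : ℕ} (hM : 0 < M) {τ : ℂ} (hτ : 0 < τ.im) :
    0 < ((M : ℂ) * (-1 / τ)).im := by
  refine im_natCast_mul_pos hM ?_
  have hτ0 : τ ≠ 0 := fun h => by simp [h] at hτ
  rw [neg_div, one_div, neg_im, Complex.inv_im, neg_div, neg_neg]
  exact div_pos hτ (Complex.normSq_pos.2 hτ0)

/-- The modular transformation of the twisted completed Appell function. -/
theorem appellPsi_modular {M N : ℕ} [NeZero M] (hN : 0 < N) (hcop : Nat.Coprime N M)
    {ε ε' j k : ℝ} {J K : ℤ} (hj : j + ε' = J) (hk : k + ε' = K) {r s : ZMod M → ℤ}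
    (hr : ∀ x, ((r x : ℤ) : ZMod M) = x) (hs : ∀ y, ((s y : ℤ) : ZMod M) = y)
    {τ z₁ : ℂ} (hτ : 0 < τ.im) (z₂ : ℂ)
    (hz : ∀ c d : ℤ, z₁ ≠ (j + c) + (-ε + d) * τ) :
    cexp (-(2 * Real.pi * I * N / M * (z₁ * z₂ / τ))) *
        appellPsi M N ε j k (-1 / τ) (z₁ / τ) (z₂ / τ) =
      τ / M * ∑ x : ZMod M, ∑ y : ZMod M,
        cexp (-(2 * Real.pi * I * N / M * ((ε + r x) * k + (ε + s y) * j))) *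
          appellPsi M N ε' (ε + r x) (ε + s y) τ z₁ z₂ := by
  have hM0 : 0 < M := Nat.pos_of_ne_zero (NeZero.ne M)
  have hM : (M : ℂ) ≠ 0 := by exact_mod_cast hM0.ne'
  have hMZ : (M : ℤ) ≠ 0 := by exact_mod_cast hM0.ne'
  have hτ0 : τ ≠ 0 := fun h => by simp [h] at hτ
  have hMτ := im_natCast_mul_pos hM0 hτ
  have hinv := im_natCast_mul_inv_pos hM0 hτ
  have hj' : (j : ℂ) = J - ε' := by
    rw [eq_sub_iff_add_eq]
    exact_mod_cast hj
  set g : ℤ × ℤ → ℂ := fun x => cexp (2 * Real.pi * I * N * ε * x.2) *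
    pairedTerm M N τ z₁ z₂ k (ε + x.1) (-j - M * x.2) with hg
  have hleft := fun l n : ℤ => latticeTerm_inv_eq_pairedTerm (M := M) N hτ z₁ z₂ ε j k l n
  have hpoleL : ∀ c d : ℤ, z₁ / τ + j * (-1 / τ) + ε ≠ c + d * (M * (-1 / τ)) := by
    intro c d h
    apply hz (-(d * M)) c
    field_simp at h
    push_cast
    linear_combination h
  have hsL := summable_latticeTerm hN hinv (p := (z₁ / τ + j * (-1 / τ) + ε,
    z₂ / τ + k * (-1 / τ) + ε, (starRingEnd ℂ) (z₁ / τ + j * (-1 / τ) + ε) +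
      (z₂ / τ + k * (-1 / τ) + ε) - (starRingEnd ℂ) (z₂ / τ + k * (-1 / τ) + ε))) hpoleL
  have hgs : Summable g := by
    have h1 := ((hsL.mul_left (qpow (-1 / τ) (N * j * k / M) *
      cexp (2 * Real.pi * I * N / M * (k * (z₁ / τ) + j * (z₂ / τ))))).mul_left
        (cexp (-(2 * Real.pi * I * N / M * (z₁ * z₂ / τ))))).mul_left τ⁻¹
    have h2 := h1.prod_symm
    refine h2.congr fun x => ?_
    simp only [Prod.swap]
    rw [hleft, inv_mul_cancel_left₀ hτ0]
  have hL : cexp (-(2 * Real.pi * I * N / M * (z₁ * z₂ / τ))) *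
      appellPsi M N ε j k (-1 / τ) (z₁ / τ) (z₂ / τ) =
        I / (2 * Real.pi) * (τ * ∑' x, g x) := by
    unfold appellPsi appellSum
    rw [← (Equiv.prodComm ℤ ℤ).tsum_eq g, ← tsum_mul_left (a := τ), mul_left_comm _ (I / _),
      mul_left_comm _ (I / _), ← tsum_mul_left, ← tsum_mul_left]
    congr 1
    refine tsum_congr fun x => ?_
    exact hleft x.1 x.2
  set F : ℤ → ℤ → ℂ := fun a n => pairedTerm M N τ z₁ z₂ k (ε + a) (n + ε') *
    ∑ y : ZMod M, cexp (-(2 * Real.pi * I * N / M * ((ε + s y) * (n + J : ℤ)))) with hF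
  -- Only `n = -J - M l` survives the character sum, with weight `M`; these are precisely the terms
  -- from the inverted side.
  have hFg : ∀ a : ℤ, ∑' n : ℤ, F a n = M * ∑' l : ℤ, g (a, l) := by
    intro a
    have hinj : Function.Injective fun l : ℤ => -J - M * l := fun l l' h =>
      mul_left_cancel₀ hMZ (sub_right_injective h)
    have hsupp : Function.support (F a) ⊆ Set.range fun l : ℤ => -J - M * l := by
      intro n hn
      rw [Function.mem_support] at hn
      by_contra hnot
      apply hn
      simp only [hF]
      rw [sum_zmod_exp hcop hs, if_neg, mul_zero]
      rintro ⟨q, hq⟩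
      exact hnot ⟨-q, by simp only; linarith⟩
    rw [← hinj.tsum_eq hsupp, ← tsum_mul_left]
    refine tsum_congr fun l => ?_
    simp only [hF, hg]
    rw [sum_zmod_exp hcop hs, if_pos ⟨-l, by ring⟩]
    have h1 : ((-J - M * l : ℤ) : ℂ) + ε' = -j - M * l := by
      rw [hj']
      push_cast
      ring
    have h2 : -(2 * Real.pi * I * N / M * (ε * ((-J - M * l + J : ℤ) : ℂ))) =
        2 * Real.pi * I * N * ε * l := by
      push_cast
      field_simp
      ring
    rw [h1, h2]
    ring
  have hHs : Summable fun a : ℤ => ∑' n : ℤ, F a n := by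
    simp_rw [hFg]
    exact hgs.prod.mul_left _
  have hterm := fun (x y : ZMod M) (l n : ℤ) =>
    latticeTerm_eq_pairedTerm (M := M) N hτ z₁ z₂ ε' (ε + r x) (ε + s y) j k hk l n
      (d := n + J) (by push_cast; linarith)
  have hpoleR : ∀ (x : ZMod M) (c d : ℤ),
      z₁ + ((ε + r x : ℝ) : ℂ) * τ + ε' ≠ c + d * (M * τ) := by
    intro x c d h
    apply hz (c - J) (d * M - r x)
    rw [hj']
    push_cast at h ⊢
    linear_combination h
  have hrow : ∀ x : ZMod M, ∑ y : ZMod M,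
      cexp (-(2 * Real.pi * I * N / M * ((ε + r x) * k + (ε + s y) * j))) *
        appellPsi M N ε' (ε + r x) (ε + s y) τ z₁ z₂ =
      I / (2 * Real.pi) * ∑' l : ℤ, ∑' n : ℤ, F (r x + M * l) n := by
    intro x
    have hsy : ∀ y : ZMod M, Summable fun p : ℤ × ℤ =>
        pairedTerm M N τ z₁ z₂ k (((ε + r x : ℝ) : ℂ) + M * p.1) (p.2 + ε') *
          cexp (-(2 * Real.pi * I * N / M * (((ε + s y : ℝ) : ℂ) * (p.2 + J : ℤ)))) := by
      intro y
      have h1 := ((summable_latticeTerm hN hMτ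
        (p := (z₁ + ((ε + r x : ℝ) : ℂ) * τ + ε', z₂ + ((ε + s y : ℝ) : ℂ) * τ + ε',
          (starRingEnd ℂ) (z₁ + ((ε + r x : ℝ) : ℂ) * τ + ε') +
            (z₂ + ((ε + s y : ℝ) : ℂ) * τ + ε') -
              (starRingEnd ℂ) (z₂ + ((ε + s y : ℝ) : ℂ) * τ + ε'))) (hpoleR x)).mul_left
        (qpow τ (N * ((ε + r x : ℝ) : ℂ) * ((ε + s y : ℝ) : ℂ) / M) *
          cexp (2 * Real.pi * I * N / M *
            (((ε + s y : ℝ) : ℂ) * z₁ + ((ε + r x : ℝ) : ℂ) * z₂)))).mul_left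
        (cexp (-(2 * Real.pi * I * N / M *
          (((ε + r x : ℝ) : ℂ) * k + ((ε + s y : ℝ) : ℂ) * j))))
      exact h1.congr fun p => hterm x y p.1 p.2
    have hFsum : ∀ p : ℤ × ℤ, ∑ y : ZMod M,
        pairedTerm M N τ z₁ z₂ k (((ε + r x : ℝ) : ℂ) + M * p.1) (p.2 + ε') *
          cexp (-(2 * Real.pi * I * N / M * (((ε + s y : ℝ) : ℂ) * (p.2 + J : ℤ)))) =
        F (r x + M * p.1) p.2 := by
      intro p
      simp only [hF]
      rw [Finset.mul_sum]
      refine Finset.sum_congr rfl fun y _ => ?_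
      push_cast
      rw [add_assoc (ε : ℂ)]
    have hFs : Summable fun p : ℤ × ℤ => F (r x + M * p.1) p.2 :=
      (summable_sum (s := Finset.univ) fun y _ => hsy y).congr fun p => hFsum p
    rw [← hFs.tsum_prod, ← tsum_congr hFsum, Summable.tsum_finsetSum fun y _ => hsy y,
      Finset.mul_sum]
    refine Finset.sum_congr rfl fun y _ => ?_
    rw [← tsum_congr fun p : ℤ × ℤ => hterm x y p.1 p.2, tsum_mul_left, tsum_mul_left]
    unfold appellPsi appellSum
    push_cast
    ring
  rw [hL]
  simp_rw [hrow]
  rw [← Finset.mul_sum, ← tsum_int_eq_sum_zmod hr hHs]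
  simp_rw [hFg]
  rw [tsum_mul_left, ← hgs.tsum_prod]
  field_simp

end

/-! ### Differentiability of the completed functions and their poles -/

section

open Complex Filter Topology

lemma eventually_ne_lattice {τ z : ℂ} (hτ : 0 < τ.im) (hz : ∀ r s : ℤ, z ≠ r + s * τ) :
    ∀ᶠ w in 𝓝 z, ∀ r s : ℤ, w ≠ r + s * τ := by
  obtain ⟨δ, hδ, hle⟩ := exists_le_norm_add_lattice hτ hz
  filter_upwards [Metric.ball_mem_nhds z hδ] with w hw r s h
  have h1 := hle (-s) (-r)
  rw [Metric.mem_ball, dist_comm, dist_eq_norm, h] at hw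
  rw [show z + (((-s : ℤ) : ℂ) * τ + ((-r : ℤ) : ℂ)) = z - (r + s * τ) by push_cast; ring] at h1
  linarith

lemma differentiableAt_PhiTilde (m : ℕ) {τ : ℂ} (hτ : 0 < τ.im) {z₁ z₂ : ℂ} (t : ℂ)
    (hz₁ : ∀ r s : ℤ, z₁ ≠ r + s * τ) (hz₂ : ∀ r s : ℤ, z₂ ≠ r + s * τ) :
    DifferentiableAt ℝ (fun p : ℂ × ℂ × ℂ => PhiTilde m τ p.1 p.2.1 p.2.2) (z₁, z₂, t) := by
  have hz₂' : ∀ r s : ℤ, -z₂ ≠ r + s * τ := fun r s h => hz₂ (-r) (-s) (by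
    push_cast
    linear_combination -h)
  have hev : (fun p : ℂ × ℂ × ℂ => PhiTilde m τ p.1 p.2.1 p.2.2) =ᶠ[𝓝 (z₁, z₂, t)]
      fun p => cexp (2 * Real.pi * I * (m + 1) * p.2.2) *
        (appellSum (m + 1) τ p.1 p.2.1 - appellSum (m + 1) τ (-p.2.1) (-p.1)) := by
    have h1 : ∀ᶠ p : ℂ × ℂ × ℂ in 𝓝 (z₁, z₂, t), ∀ r s : ℤ, p.1 ≠ r + s * τ :=
      continuousAt_fst.eventually (eventually_ne_lattice hτ hz₁)
    have h2 : ∀ᶠ p : ℂ × ℂ × ℂ in 𝓝 (z₁, z₂, t), ∀ r s : ℤ, p.2.1 ≠ r + s * τ :=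
      Tendsto.eventually (f := fun p : ℂ × ℂ × ℂ => p.2.1)
        (Continuous.tendsto (by fun_prop) (z₁, z₂, t)) (eventually_ne_lattice hτ hz₂)
    filter_upwards [h1, h2] with p hp1 hp2
    exact PhiTilde_eq_appellSum m hτ p.2.2 hp1 hp2
  refine DifferentiableAt.congr_of_eventuallyEq ?_ hev
  have hA : DifferentiableAt ℝ (fun p : ℂ × ℂ × ℂ => appellSum (m + 1) τ p.1 p.2.1) (z₁, z₂, t) :=
    (differentiableAt_appellSum (Nat.succ_pos m) hτ hz₁).comp (z₁, z₂, t)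
      (f := fun p : ℂ × ℂ × ℂ => (p.1, p.2.1)) (by fun_prop)
  have hB : DifferentiableAt ℝ (fun p : ℂ × ℂ × ℂ => appellSum (m + 1) τ (-p.2.1) (-p.1))
      (z₁, z₂, t) :=
    (differentiableAt_appellSum (z₂ := -z₁) (Nat.succ_pos m) hτ hz₂').comp (z₁, z₂, t)
      (f := fun p : ℂ × ℂ × ℂ => (-p.2.1, -p.1)) (by fun_prop)
  have hE : DifferentiableAt ℝ (fun p : ℂ × ℂ × ℂ => cexp (2 * Real.pi * I * (m + 1) * p.2.2))
      (z₁, z₂, t) := by fun_prop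
  exact hE.mul (hA.sub hB)

lemma differentiableAt_PsiTilde {M : ℕ} (m : ℕ) (ε j k : ℂ) {τ : ℂ}
    (hτ : 0 < ((M : ℂ) * τ).im) {z₁ z₂ : ℂ} (t : ℂ)
    (hz₁ : ∀ r s : ℤ, z₁ + j * τ + ε ≠ r + s * (M * τ))
    (hz₂ : ∀ r s : ℤ, z₂ + k * τ + ε ≠ r + s * (M * τ)) :
    DifferentiableAt ℝ (fun p : ℂ × ℂ × ℂ => PsiTilde M m ε j k τ p.1 p.2.1 p.2.2)
      (z₁, z₂, t) := by
  have hP := (differentiableAt_PhiTilde m hτ (t / M) hz₁ hz₂).comp (z₁, z₂, t)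
    (f := fun p : ℂ × ℂ × ℂ => (p.1 + j * τ + ε, p.2.1 + k * τ + ε, p.2.2 / M)) (by fun_prop)
  have hE : DifferentiableAt ℝ (fun p : ℂ × ℂ × ℂ => qpow τ ((m + 1) * j * k / M) *
    cexp (2 * Real.pi * I * (m + 1) / M * (k * p.1 + j * p.2.1))) (z₁, z₂, t) := by fun_prop
  exact hE.mul hP

lemma PsiTilde_eq_appellPsi {M : ℕ} (m : ℕ) (ε j k : ℂ) {τ : ℂ}
    (hτ : 0 < ((M : ℂ) * τ).im) {z₁ z₂ : ℂ} (t : ℂ)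
    (hz₁ : ∀ r s : ℤ, z₁ + j * τ + ε ≠ r + s * (M * τ))
    (hz₂ : ∀ r s : ℤ, z₂ + k * τ + ε ≠ r + s * (M * τ)) :
    PsiTilde M m ε j k τ z₁ z₂ t = cexp (2 * Real.pi * I * (m + 1) * (t / M)) *
      (appellPsi M (m + 1) ε j k τ z₁ z₂ - appellPsi M (m + 1) (-ε) (-k) (-j) τ (-z₂) (-z₁)) := by
  unfold PsiTilde appellPsi
  rw [PhiTilde_eq_appellSum m hτ _ hz₁ hz₂,
    show -z₂ + -k * τ + -ε = -(z₂ + k * τ + ε) by ring,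
    show -z₁ + -j * τ + -ε = -(z₁ + j * τ + ε) by ring,
    show -j * -z₂ + -k * -z₁ = k * z₁ + j * z₂ by ring,
    show ((m + 1 : ℕ) : ℂ) * -k * -j / M = (m + 1 : ℕ) * j * k / M by ring]
  push_cast
  ring

/-- Since `2ε` is an integer, `-ε` and `ε` define the same coset of `ℤ`, which matches the poles of
the inverted function to the excluded set. -/
lemma ne_lattice_inv {M : ℕ} {ε ε' j z τ : ℂ} {n : ℤ} (hτ : τ ≠ 0) (hε : ∃ e : ℤ, 2 * ε = e)
    (hj : j = ε' + n) (hz : ∀ c d : ℤ, z ≠ (ε' + c) + (ε + d) * τ) (r s : ℤ) :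
    z / τ + j * (-1 / τ) + ε ≠ r + s * (M * (-1 / τ)) := by
  obtain ⟨e, he⟩ := hε
  intro h
  apply hz (n - s * M) (r - e)
  field_simp at h
  push_cast
  rw [← he]
  rw [hj] at h
  linear_combination h

lemma ne_lattice_shift {M : ℕ} {ε ε' a z τ : ℂ} {n : ℤ} (hε : ∃ e : ℤ, 2 * ε = e)
    (hε' : ∃ e : ℤ, 2 * ε' = e) (ha : a = ε + n)
    (hz : ∀ c d : ℤ, z ≠ (ε' + c) + (ε + d) * τ) (r s : ℤ) :
    z + a * τ + ε' ≠ r + s * (M * τ) := by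
  obtain ⟨e, he⟩ := hε
  obtain ⟨e', he'⟩ := hε'
  intro h
  apply hz (r - e') (s * M - n - e)
  push_cast
  rw [← he, ← he']
  rw [ha] at h
  linear_combination h

/-! ### The operator `D₁` under the modular substitution -/

/-- The holomorphic part of a real-linear map. -/
def holPart (L : ℂ × ℂ × ℂ →L[ℝ] ℂ) (v : ℂ × ℂ × ℂ) : ℂ := (L v - I * L (I • v)) / 2

lemma holPart_smul_right (L : ℂ × ℂ × ℂ →L[ℝ] ℂ) (c : ℂ) (v : ℂ × ℂ × ℂ) :
    holPart L (c • v) = c * holPart L v := by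
  have hreal : ∀ (x : ℝ) (w : ℂ × ℂ × ℂ), L ((x : ℂ) • w) = x * L w := fun x w => by
    rw [Complex.coe_smul, map_smul, real_smul]
  have h1 : L (c • v) = c.re * L v + c.im * L (I • v) := by
    conv_lhs => rw [← re_add_im c, add_smul, mul_smul, map_add, hreal, hreal]
  have h2 : L (I • c • v) = c.re * L (I • v) - c.im * L v := by
    have : I • c • v = (c.re : ℂ) • (I • v) + ((-c.im : ℝ) : ℂ) • v := by
      rw [smul_smul, smul_smul, ← add_smul]
      congr 1
      conv_lhs => rw [← re_add_im c]
      push_cast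
      linear_combination (c.im : ℂ) * I_sq
    rw [this, map_add, hreal, hreal]
    push_cast
    ring
  unfold holPart
  rw [h1, h2]
  conv_rhs => rw [← re_add_im c]
  linear_combination (c.im : ℂ) * L (I • v) / 2 * I_sq

lemma holPart_add_right (L : ℂ × ℂ × ℂ →L[ℝ] ℂ) (v w : ℂ × ℂ × ℂ) :
    holPart L (v + w) = holPart L v + holPart L w := by
  unfold holPart
  rw [smul_add, map_add, map_add]
  ring

lemma holPart_sum_smul {ι : Type*} (s : Finset ι) (c : ι → ℂ) (L : ι → ℂ × ℂ × ℂ →L[ℝ] ℂ)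
    (v : ℂ × ℂ × ℂ) : holPart (∑ i ∈ s, c i • L i) v = ∑ i ∈ s, c i * holPart (L i) v := by
  unfold holPart
  simp only [sum_apply, smul_apply, smul_eq_mul,
    Finset.mul_sum]
  rw [← Finset.sum_sub_distrib, Finset.sum_div]
  refine Finset.sum_congr rfl fun i _ => ?_
  ring

/-- `D₁` is the holomorphic part of the real derivative in a fixed direction. -/
lemma D₁_eq_holPart {F : ℂ → ℂ → ℂ → ℂ → ℂ} {τ z₁ z₂ t : ℂ} {L : ℂ × ℂ × ℂ →L[ℝ] ℂ}
    (hF : HasFDerivAt (fun p : ℂ × ℂ × ℂ => F τ p.1 p.2.1 p.2.2) L (z₁, z₂, t)) :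
    D₁ F τ z₁ z₂ t =
      1 / (2 * Real.pi * I) * holPart L (1, -1, -((z₁ - z₂) / (2 * τ))) := by
  have h1 : wirtinger (fun w => F τ w z₂ t) z₁ = holPart L (1, 0, 0) := by
    have hi : HasFDerivAt (fun w : ℂ => (w, z₂, t)) (ContinuousLinearMap.inl ℝ ℂ (ℂ × ℂ)) z₁ :=
      hasFDerivAt_prodMk_left z₁ (z₂, t)
    have h := hF.comp z₁ hi
    unfold wirtinger holPart
    rw [show (fun w => F τ w z₂ t) = (fun p : ℂ × ℂ × ℂ => F τ p.1 p.2.1 p.2.2) ∘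
      fun w : ℂ => (w, z₂, t) from rfl, h.fderiv]
    simp [← Prod.zero_eq_mk]
  have h2 : wirtinger (fun w => F τ z₁ w t) z₂ = holPart L (0, 1, 0) := by
    have hi : HasFDerivAt (fun w : ℂ => (z₁, w, t)) _ z₂ :=
      (hasFDerivAt_prodMk_right z₁ (z₂, t)).comp z₂ (hasFDerivAt_prodMk_left (𝕜 := ℝ) z₂ t)
    have h := hF.comp z₂ hi
    unfold wirtinger holPart
    rw [show (fun w => F τ z₁ w t) = (fun p : ℂ × ℂ × ℂ => F τ p.1 p.2.1 p.2.2) ∘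
      fun w : ℂ => (z₁, w, t) from rfl, h.fderiv]
    simp
  have h3 : wirtinger (fun w => F τ z₁ z₂ w) t = holPart L (0, 0, 1) := by
    have hi : HasFDerivAt (fun w : ℂ => (z₁, z₂, w)) _ t :=
      (hasFDerivAt_prodMk_right z₁ (z₂, t)).comp t (hasFDerivAt_prodMk_right (𝕜 := ℝ) z₂ t)
    have h := hF.comp t hi
    unfold wirtinger holPart
    rw [show (fun w => F τ z₁ z₂ w) = (fun p : ℂ × ℂ × ℂ => F τ p.1 p.2.1 p.2.2) ∘
      fun w : ℂ => (z₁, z₂, w) from rfl, h.fderiv]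
    simp
  have hv : ((1, -1, -((z₁ - z₂) / (2 * τ))) : ℂ × ℂ × ℂ) =
      (1, 0, 0) + ((-1 : ℂ) • (0, 1, 0) + (-((z₁ - z₂) / (2 * τ)) : ℂ) • (0, 0, 1)) := by
    simp
  unfold D₁
  rw [h1, h2, h3, hv, holPart_add_right, holPart_add_right, holPart_smul_right,
    holPart_smul_right]
  ring

/-- `D₁` raises the weight of a modular transformation law by one. -/
lemma D₁_modular {ι : Type*} (s : Finset ι) {F : ℂ → ℂ → ℂ → ℂ → ℂ}
    {G : ι → ℂ → ℂ → ℂ → ℂ → ℂ} (c : ι → ℂ) {τ z₁ z₂ t : ℂ} (hτ : τ ≠ 0)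
    (hF : DifferentiableAt ℝ (fun p : ℂ × ℂ × ℂ => F (-1 / τ) p.1 p.2.1 p.2.2)
      (z₁ / τ, z₂ / τ, t - z₁ * z₂ / τ))
    (hG : ∀ i ∈ s, DifferentiableAt ℝ (fun p : ℂ × ℂ × ℂ => G i τ p.1 p.2.1 p.2.2) (z₁, z₂, t))
    (hFG : ∀ᶠ p : ℂ × ℂ × ℂ in 𝓝 (z₁, z₂, t),
      F (-1 / τ) (p.1 / τ) (p.2.1 / τ) (p.2.2 - p.1 * p.2.1 / τ) =
        ∑ i ∈ s, c i * G i τ p.1 p.2.1 p.2.2) :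
    D₁ F (-1 / τ) (z₁ / τ) (z₂ / τ) (t - z₁ * z₂ / τ) =
      τ * ∑ i ∈ s, c i * D₁ (G i) τ z₁ z₂ t := by
  set φ : ℂ × ℂ × ℂ → ℂ × ℂ × ℂ := fun p => (p.1 / τ, p.2.1 / τ, p.2.2 - p.1 * p.2.1 / τ) with hφ
  have hdiff : DifferentiableAt ℂ φ (z₁, z₂, t) := by
    rw [hφ]
    fun_prop
  set φ' := fderiv ℂ φ (z₁, z₂, t) with hφ'
  have hφd : HasFDerivAt φ φ' (z₁, z₂, t) := hdiff.hasFDerivAt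
  -- The third component on the right is the coefficient of `D₁` at the image point: `-(z₁/τ - z₂/τ)
  -- / (2 · (-1/τ)) = (z₁ - z₂)/2`. The `∂/∂t` term in `D₁` is what makes the directions correspond.
  have hφv : φ' (1, -1, -((z₁ - z₂) / (2 * τ))) = τ⁻¹ • (1, -1, (z₁ - z₂) / 2) := by
    have hfst : HasFDerivAt (fun p : ℂ × ℂ × ℂ => p.1) (ContinuousLinearMap.fst ℂ ℂ (ℂ × ℂ))
      (z₁, z₂, t) := hasFDerivAt_fst
    have hsnd : HasFDerivAt (fun p : ℂ × ℂ × ℂ => p.2) (ContinuousLinearMap.snd ℂ ℂ (ℂ × ℂ))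
      (z₁, z₂, t) := hasFDerivAt_snd
    have e1 := hfst.mul_const τ⁻¹
    have e2 := hsnd.fst.mul_const τ⁻¹
    have e3 := hsnd.snd.sub ((hfst.mul hsnd.fst).mul_const τ⁻¹)
    have e : HasFDerivAt φ _ (z₁, z₂, t) := e1.prodMk (e2.prodMk e3)
    rw [hφd.unique e]
    ext
    · simp
    · simp
    · simp
      field_simp
      ring
  have hcomp := hF.hasFDerivAt.comp (z₁, z₂, t) (hφd.restrictScalars ℝ)
  have hsum : HasFDerivAt (fun p : ℂ × ℂ × ℂ => ∑ i ∈ s, c i * G i τ p.1 p.2.1 p.2.2)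
      (∑ i ∈ s, c i • fderiv ℝ (fun p : ℂ × ℂ × ℂ => G i τ p.1 p.2.1 p.2.2) (z₁, z₂, t))
      (z₁, z₂, t) :=
    HasFDerivAt.fun_sum fun i hi => (hG i hi).hasFDerivAt.const_mul (c i)
  have heq := (hcomp.congr_of_eventuallyEq (hFG.mono fun p hp => hp.symm)).unique hsum
  rw [D₁_eq_holPart hF.hasFDerivAt]
  have hdir : ((1, -1, -((z₁ / τ - z₂ / τ) / (2 * (-1 / τ)))) : ℂ × ℂ × ℂ) =
      τ • φ' (1, -1, -((z₁ - z₂) / (2 * τ))) := by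
    rw [hφv, smul_smul, mul_inv_cancel₀ hτ, one_smul]
    congr 2
    field_simp
  -- As `φ` is holomorphic, `φ'` commutes with multiplication by `I`, so taking holomorphic parts is
  -- compatible with the chain rule.
  have hchain : ∀ (L : ℂ × ℂ × ℂ →L[ℝ] ℂ) (v : ℂ × ℂ × ℂ),
      holPart L (φ' v) = holPart (L.comp (φ'.restrictScalars ℝ)) v := fun L v => by
    unfold holPart
    simp
  rw [hdir, holPart_smul_right, hchain, heq, holPart_sum_smul, Finset.mul_sum, Finset.mul_sum,
    Finset.mul_sum]
  refine Finset.sum_congr rfl fun i hi => ?_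
  rw [D₁_eq_holPart (hG i hi).hasFDerivAt]
  ring

/-! ### The transformation laws of weight one and two -/

/-- The modular transformation of `PsiTilde`, of weight one. -/
theorem PsiTilde_modular {M m : ℕ} [NeZero M] (hcop : Nat.Coprime (m + 1) M)
    {ε ε' j k : ℝ} {J K : ℤ} (hε : ∃ e : ℤ, 2 * (ε : ℂ) = e) (hε' : ∃ e : ℤ, 2 * (ε' : ℂ) = e)
    (hj : j = ε' + J) (hk : k = ε' + K) {r s : ZMod M → ℤ}
    (hr : ∀ x, ((r x : ℤ) : ZMod M) = x) (hs : ∀ y, ((s y : ℤ) : ZMod M) = y)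
    {τ z₁ z₂ : ℂ} (hτ : 0 < τ.im) (t : ℂ)
    (hz₁ : ∀ c d : ℤ, z₁ ≠ (ε' + c) + (ε + d) * τ)
    (hz₂ : ∀ c d : ℤ, z₂ ≠ (ε' + c) + (ε + d) * τ) :
    PsiTilde M m ε j k (-1 / τ) (z₁ / τ) (z₂ / τ) (t - z₁ * z₂ / τ) =
      τ / M * ∑ x : ZMod M, ∑ y : ZMod M,
        cexp (-(2 * Real.pi * I * (m + 1 : ℕ) / M * ((ε + r x) * k + (ε + s y) * j))) *
          PsiTilde M m ε' (ε + r x) (ε + s y) τ z₁ z₂ t := by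
  have hM0 : 0 < M := Nat.pos_of_ne_zero (NeZero.ne M)
  have hτ0 : τ ≠ 0 := fun h => by simp [h] at hτ
  obtain ⟨e, he⟩ := hε
  obtain ⟨e', he'⟩ := hε'
  have hjc : (j : ℂ) = ε' + J := by exact_mod_cast hj
  have hkc : (k : ℂ) = ε' + K := by exact_mod_cast hk
  have he'r : 2 * ε' = e' := by exact_mod_cast he'
  have hpole₁ : ∀ c d : ℤ, z₁ ≠ (j + c) + (-ε + d) * τ := fun c d h => hz₁ (J + c) (d - e) (by
    push_cast
    rw [← he, h, hjc]
    ring)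
  have hpole₂ : ∀ c d : ℤ, -z₂ ≠ (((-k : ℝ) : ℂ) + c) + (-((-ε : ℝ) : ℂ) + d) * τ :=
    fun c d h => hz₂ (K - c) (-d - e) (by
      push_cast at h ⊢
      rw [← he, ← neg_neg z₂, h, hkc]
      ring)
  have h1 := appellPsi_modular (Nat.succ_pos m) hcop (J := J + e') (K := K + e')
    (by push_cast; linarith : j + ε' = _) (by push_cast; linarith : k + ε' = _) hr hs hτ z₂ hpole₁
  -- The subtracted Appell function has negated and exchanged parameters. Representatives are chosen
  -- accordingly, so that after `x ↦ -x`, `y ↦ -y` and an interchange of sums it pairs with the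
  -- first one term by term.
  have h2 := appellPsi_modular (Nat.succ_pos m) hcop (ε := -ε) (ε' := -ε') (j := -k) (k := -j)
    (J := -K - e') (K := -J - e') (by push_cast; linarith) (by push_cast; linarith)
    (r := fun x => -s (-x)) (s := fun y => -r (-y)) (fun x => by push_cast; rw [hs, neg_neg])
    (fun y => by push_cast; rw [hr, neg_neg]) hτ (-z₁) hpole₂
  rw [← Equiv.sum_comp (Equiv.neg (ZMod M)), Finset.sum_comm,
    ← Equiv.sum_comp (Equiv.neg (ZMod M))] at h2
  simp only [Equiv.neg_apply, neg_neg] at h2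
  rw [PsiTilde_eq_appellPsi m _ _ _ (im_natCast_mul_inv_pos hM0 hτ) _
    (ne_lattice_inv hτ0 ⟨e, he⟩ hjc hz₁) (ne_lattice_inv hτ0 ⟨e, he⟩ hkc hz₂)]
  have hR : ∀ x y : ZMod M, PsiTilde M m ε' (ε + r x) (ε + s y) τ z₁ z₂ t = _ := fun x y =>
    PsiTilde_eq_appellPsi m _ _ _ (im_natCast_mul_pos hM0 hτ) t
      (ne_lattice_shift ⟨e, he⟩ ⟨e', he'⟩ rfl hz₁) (ne_lattice_shift ⟨e, he⟩ ⟨e', he'⟩ rfl hz₂)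
  simp_rw [hR]
  have hpre : cexp (2 * Real.pi * I * (m + 1) * ((t - z₁ * z₂ / τ) / M)) =
      cexp (2 * Real.pi * I * (m + 1) * (t / M)) *
        cexp (-(2 * Real.pi * I * (m + 1 : ℕ) / M * (z₁ * z₂ / τ))) := by
    rw [← Complex.exp_add]
    push_cast
    ring_nf
  have hcomb : ∀ x y : ZMod M, cexp (-(2 * Real.pi * I * (m + 1 : ℕ) / M *
        ((ε + r x) * k + (ε + s y) * j))) *
      (cexp (2 * Real.pi * I * (m + 1) * (t / M)) *
        (appellPsi M (m + 1) ε' (ε + r x) (ε + s y) τ z₁ z₂ -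
          appellPsi M (m + 1) (-ε') (-(ε + s y)) (-(ε + r x)) τ (-z₂) (-z₁))) =
      cexp (2 * Real.pi * I * (m + 1) * (t / M)) *
        (cexp (-(2 * Real.pi * I * (m + 1 : ℕ) / M * ((ε + r x) * k + (ε + s y) * j))) *
          appellPsi M (m + 1) ε' (ε + r x) (ε + s y) τ z₁ z₂ -
        cexp (-(2 * Real.pi * I * (m + 1 : ℕ) / M *
            ((((-ε : ℝ) : ℂ) + (-s y : ℤ)) * ((-j : ℝ) : ℂ) +
              (((-ε : ℝ) : ℂ) + (-r x : ℤ)) * ((-k : ℝ) : ℂ)))) *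
          appellPsi M (m + 1) ((-ε' : ℝ) : ℂ) (((-ε : ℝ) : ℂ) + (-s y : ℤ))
            (((-ε : ℝ) : ℂ) + (-r x : ℤ)) τ (-z₂) (-z₁)) := fun x y => by
    push_cast
    ring_nf
  simp_rw [hcomb, ← Finset.mul_sum, Finset.sum_sub_distrib]
  rw [hpre, mul_left_comm, mul_sub (τ / M : ℂ), ← h1, ← h2]
  rw [show -z₂ * -z₁ = z₁ * z₂ by ring, show -z₂ / τ = -(z₂ / τ) by ring,
    show -z₁ / τ = -(z₁ / τ) by ring]
  push_cast
  ring

lemma exists_real_half {ε : ℂ} (hε : ε = 0 ∨ ε = 1 / 2) :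
    ∃ x : ℝ, (x : ℂ) = ε ∧ ∃ e : ℤ, 2 * (x : ℂ) = e := by
  rcases hε with rfl | rfl
  · exact ⟨0, by simp, 0, by simp⟩
  · exact ⟨1 / 2, by simp, 1, by simp⟩

/-- The modular transformation of `PsiTildeA`, of weight two. -/
theorem PsiTildeA_modular {M m : ℕ} [NeZero M] (hm : 1 ≤ m) (hcop : Nat.Coprime m M)
    {ε ε' : ℂ} (hε : ε = 0 ∨ ε = 1 / 2) (hε' : ε' = 0 ∨ ε' = 1 / 2) {j k : ℂ}
    (hj : ∃ n : ℤ, j = ε' + n) (hk : ∃ n : ℤ, k = ε' + n) {r s : ZMod M → ℤ}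
    (hr : ∀ x, ((r x : ℤ) : ZMod M) = x) (hs : ∀ y, ((s y : ℤ) : ZMod M) = y)
    {τ z₁ z₂ : ℂ} (t : ℂ) (hτ : 0 < τ.im)
    (hz₁ : ∀ c d : ℤ, z₁ ≠ (ε' + c) + (ε + d) * τ)
    (hz₂ : ∀ c d : ℤ, z₂ ≠ (ε' + c) + (ε + d) * τ) :
    PsiTildeA M m ε j k (-1 / τ) (z₁ / τ) (z₂ / τ) (t - z₁ * z₂ / τ) =
      τ ^ 2 / M * ∑ x : ZMod M, ∑ y : ZMod M,
        cexp (-(2 * Real.pi * I * m / M * ((ε + r x) * k + (ε + s y) * j))) *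
          PsiTildeA M m ε' (ε + r x) (ε + s y) τ z₁ z₂ t := by
  obtain ⟨m, rfl⟩ : ∃ n, m = n + 1 := ⟨m - 1, by omega⟩
  have hM0 : 0 < M := Nat.pos_of_ne_zero (NeZero.ne M)
  have hτ0 : τ ≠ 0 := fun h => by simp [h] at hτ
  obtain ⟨ε, rfl, hεe⟩ := exists_real_half hε
  obtain ⟨ε', rfl, hεe'⟩ := exists_real_half hε'
  obtain ⟨J, rfl⟩ := hj
  obtain ⟨K, rfl⟩ := hk
  -- Avoiding the poles is an open condition, so the weight-one law holds on a neighbourhood and may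
  -- be differentiated.
  have hopen : ∀ {z : ℂ}, (∀ c d : ℤ, z ≠ (ε' + c) + (ε + d) * τ) →
      ∀ᶠ w in 𝓝 z, ∀ c d : ℤ, w ≠ (ε' + c) + (ε + d) * τ := by
    intro z hz
    have h1 : ∀ a b : ℤ, z - ε' - ε * τ ≠ a + b * τ := fun a b h => hz a b (by
      linear_combination h)
    have h2 : ContinuousAt (fun w : ℂ => w - ε' - ε * τ) z := by fun_prop
    filter_upwards [h2.eventually (eventually_ne_lattice hτ h1)] with w hw c d h
    exact hw c d (by linear_combination h)
  have hD := D₁_modular (F := PsiTilde M m ε (ε' + J) (ε' + K))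
    (G := fun i : ZMod M × ZMod M => PsiTilde M m ε' (ε + r i.1) (ε + s i.2)) Finset.univ
    (fun i => τ / M * cexp (-(2 * Real.pi * I * (m + 1 : ℕ) / M *
      ((ε + r i.1) * (ε' + K) + (ε + s i.2) * (ε' + J))))) (z₁ := z₁) (z₂ := z₂) (t := t) hτ0
    (differentiableAt_PsiTilde m _ _ _ (im_natCast_mul_inv_pos hM0 hτ) _
      (ne_lattice_inv hτ0 hεe rfl hz₁) (ne_lattice_inv hτ0 hεe rfl hz₂))
    (fun i _ => differentiableAt_PsiTilde m _ _ _ (im_natCast_mul_pos hM0 hτ) t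
      (ne_lattice_shift hεe hεe' rfl hz₁) (ne_lattice_shift hεe hεe' rfl hz₂)) (by
      have h1 : ∀ᶠ p : ℂ × ℂ × ℂ in 𝓝 (z₁, z₂, t), ∀ c d : ℤ, p.1 ≠ (ε' + c) + (ε + d) * τ :=
        continuousAt_fst.eventually (hopen hz₁)
      have h2 : ∀ᶠ p : ℂ × ℂ × ℂ in 𝓝 (z₁, z₂, t), ∀ c d : ℤ, p.2.1 ≠ (ε' + c) + (ε + d) * τ :=
        Tendsto.eventually (f := fun p : ℂ × ℂ × ℂ => p.2.1)
          (Continuous.tendsto (by fun_prop) (z₁, z₂, t)) (hopen hz₂)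
      filter_upwards [h1, h2] with p hp1 hp2
      have h := PsiTilde_modular (j := ε' + J) (k := ε' + K) hcop hεe hεe' rfl rfl hr hs hτ p.2.2
        hp1 hp2
      push_cast at h ⊢
      rw [h, Fintype.sum_prod_type, Finset.mul_sum]
      refine Finset.sum_congr rfl fun x _ => ?_
      rw [Finset.mul_sum]
      refine Finset.sum_congr rfl fun y _ => ?_
      exact (mul_assoc _ _ _).symm)
  unfold PsiTildeA
  rw [Nat.add_sub_cancel, hD, Fintype.sum_prod_type, Finset.mul_sum, Finset.mul_sum]
  refine Finset.sum_congr rfl fun x _ => ?_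
  rw [Finset.mul_sum, Finset.mul_sum]
  refine Finset.sum_congr rfl fun y _ => ?_
  ring

/-- This makes the untwisted law a special case of the twisted one. -/
lemma PsiTilde_one (m : ℕ) : PsiTilde 1 m 0 0 0 = PhiTilde m := by
  funext τ z₁ z₂ t
  simp [PsiTilde, qpow]

/-- The modular transformation of `PhiTildeA`, of weight two. -/
theorem PhiTildeA_modular {m : ℕ} (hm : 1 ≤ m) {τ z₁ z₂ : ℂ} (t : ℂ) (hτ : 0 < τ.im)
    (hz₁ : ∀ r s : ℤ, z₁ ≠ r + s * τ) (hz₂ : ∀ r s : ℤ, z₂ ≠ r + s * τ) :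
    PhiTildeA m (-1 / τ) (z₁ / τ) (z₂ / τ) (t - z₁ * z₂ / τ) =
      τ ^ 2 * PhiTildeA m τ z₁ z₂ t := by
  have h := PsiTildeA_modular (M := 1) (ε := 0) (ε' := 0) (j := 0) (k := 0) hm
    (Nat.coprime_one_right m) (Or.inl rfl) (Or.inl rfl) ⟨0, by simp⟩ ⟨0, by simp⟩
    (r := fun _ => 0) (s := fun _ => 0) (fun x => Subsingleton.elim _ _)
    (fun x => Subsingleton.elim _ _) t hτ
    (fun c d => by simpa using hz₁ c d) (fun c d => by simpa using hz₂ c d)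
  have huniv : (Finset.univ : Finset (ZMod 1)) = {0} := rfl
  simpa [PsiTildeA, PsiTilde_one, PhiTildeA, huniv] using h

end

end MockTheta

end

theorem theorem8p2 :
    -- (a); `z₁, z₂` stay off the poles, where the functions are real-differentiable
    (∀ m : ℕ, 1 ≤ m → ∀ τ z₁ z₂ t : ℂ, 0 < τ.im →
      (∀ r s : ℤ, z₁ ≠ r + s * τ) → (∀ r s : ℤ, z₂ ≠ r + s * τ) →
        DifferentiableAt ℝ
            (fun p : ℂ × ℂ × ℂ => MockTheta.PhiTilde (m - 1) τ p.1 p.2.1 p.2.2) (z₁, z₂, t) ∧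
          MockTheta.PhiTildeA m (-1 / τ) (z₁ / τ) (z₂ / τ) (t - z₁ * z₂ / τ) =
            τ ^ 2 * MockTheta.PhiTildeA m τ z₁ z₂ t) ∧
    -- (b); `r` and `s` choose arbitrary representatives `a = ε + r x`, `b = ε + s y` of
    -- the classes in `ε + ℤ / Mℤ`
    (∀ (M m : ℕ) [NeZero M], 1 ≤ m → (1 < m → Nat.gcd M (2 * m) = 1) →
      ∀ ε ε' : ℂ, (ε = 0 ∨ ε = 1 / 2) → (ε' = 0 ∨ ε' = 1 / 2) →
      ∀ j k : ℂ, (∃ n : ℤ, j = ε' + n) → (∃ n : ℤ, k = ε' + n) →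
      ∀ r s : ZMod M → ℤ, (∀ x, ((r x : ℤ) : ZMod M) = x) → (∀ y, ((s y : ℤ) : ZMod M) = y) →
      ∀ τ z₁ z₂ t : ℂ, 0 < τ.im →
      (∀ c d : ℤ, z₁ ≠ (ε' + c) + (ε + d) * τ) → (∀ c d : ℤ, z₂ ≠ (ε' + c) + (ε + d) * τ) →
        MockTheta.PsiTildeA M m ε j k (-1 / τ) (z₁ / τ) (z₂ / τ) (t - z₁ * z₂ / τ) =
          τ ^ 2 / M * ∑ x : ZMod M, ∑ y : ZMod M,
            Complex.exp (-(2 * Real.pi * Complex.I * m / M *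
                ((ε + r x) * k + (ε + s y) * j))) *
              MockTheta.PsiTildeA M m ε' (ε + r x) (ε + s y) τ z₁ z₂ t) := by
  refine ⟨fun m hm τ z₁ z₂ t hτ hz₁ hz₂ =>
    ⟨MockTheta.differentiableAt_PhiTilde (m - 1) hτ t hz₁ hz₂,
      MockTheta.PhiTildeA_modular hm t hτ hz₁ hz₂⟩, ?_⟩
  intro M m _ hm hgcd ε ε' hε hε' j k hj hk r s hr hs τ z₁ z₂ t hτ hz₁ hz₂
  have hcop : Nat.Coprime m M := by
    rcases hm.eq_or_lt with rfl | h
    · exact Nat.coprime_one_left M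
    · exact (Nat.Coprime.coprime_mul_left_right (hgcd h)).symm
  exact MockTheta.PsiTildeA_modular hm hcop hε hε' hj hk hr hs t hτ hz₁ hz₂
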